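/- Consider the scalar delay differential equation $$\ddot x(t)+a(t)\,\dot x(g(t))+b(t)\,x(h(t))=0,\qquad t\ge 0, \tag{1}$$ where $a,b$ are Lebesgue measurable and essentially bounded on $[0,\infty)$, and $g,h:[0,\infty)\to\mathbb R$ are Lebesgue measurable with $g(t)\le t$, $h(t)\le t$ for $t\ge 0$. For $t_0\ge 0$, bounded Borel measurable $\varphi,\psi:(-\infty,t_0)\to\mathbb R$ and $x_0,x_0'\in\mathbb R$, a solution of (1) with the initial data $x(t)=\varphi(t)$, $\dot x(t)=\psi(t)$ for $t<t_0$, $x(t_0)=x_0$, $\dot x(t_0)=x_0'$ is a function $x$ whose derivative $\dot x$ is locally absolutely continuous on $[t_0,\infty)$ and which satisfies (1) for almost every $t\ge t_0$ (for arguments less than $t_0$ the values of $x$ and $\dot x$ are those of $\varphi$ and $\psi$; $\psi$ need not be the derivative of $\varphi$). Equation (1) is called (uniformly) exponentially stable if there are $M>0$, $\mu>0$, independent of $t_0$ and of the initial data, such that for all $t_0\ge0$ and all such initial data the solution satisfies $$|x(t)|\le M e^{-\mu(t-t_0)}\Big[|x(t_0)|+|\dot x(t_0)|+\sup_{s<t_0}\big(|\varphi(s)|+|\psi(s)|\big)\Big],\qquad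 t\ge t_0 .$$ Theorem. Suppose that for some $t_0\ge 0$ $$\operatorname*{ess\,inf}_{t\ge t_0}a(t)>0,\qquad \operatorname*{ess\,inf}_{t\ge t_0}b(t)>0,\qquad \Big(\operatorname*{ess\,inf}_{t\ge t_0}a(t)\Big)^2\ge 4\operatorname*{ess\,sup}_{t\ge t_0}b(t),$$ that $$\int_{\max\{g(t),0\}}^t a(s)\,ds\le \frac1e,\qquad t\ge t_0,$$ and that $t-g(t)\le\delta$ and $t-h(t)\le\tau$ for all $t\ge t_0$, with constants $\delta,\tau$. If for some $t_1\ge t_0+\delta$ $$\delta\left\|\frac ab\right\|\left(\|a\|\left\|\frac ba\right\|+\|b\|\right)+\tau\left\|\frac ba\right\|<1,$$ where $\|\cdot\|$ is the norm of $L_\infty[t_1,\infty)$, then equation (1) is exponentially stable. -/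

import Mathlib

open MeasureTheory

namespace SecondOrderDelay

/-- `x` together with its velocity `v` solves the initial value problem
`x''(t) + a(t) x'(g(t)) + b(t) x(h(t)) = 0` for `t ≥ t₀`,
`x(t) = φ(t)`, `x'(t) = ψ(t)` for `t < t₀`, `x(t₀) = x₀`, `x'(t₀) = x₀'`.

The velocity is carried along as a function on the whole line because the prescribed past
velocity `ψ` need not be the derivative of the prescribed past position `φ`. On `[t₀, ∞)` the
function `v` is the derivative of `x` (one-sided at `t₀`), it is locally absolutely continuous,
and the equation holds almost everywhere. -/
structure IsSolution (a b g h : ℝ → ℝ) (t₀ : ℝ) (φ ψ : Set.Iio t₀ → ℝ) (x₀ x₀' : ℝ)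
    (x v : ℝ → ℝ) : Prop where
  past_pos : ∀ s : Set.Iio t₀, x s = φ s
  past_vel : ∀ s : Set.Iio t₀, v s = ψ s
  init_pos : x t₀ = x₀
  init_vel : v t₀ = x₀'
  hasDeriv : ∀ t, t₀ ≤ t → HasDerivWithinAt x (v t) (Set.Ici t₀) t
  absCont : ∀ T, t₀ ≤ T → AbsolutelyContinuousOnInterval v t₀ T
  equation : ∀ᵐ t ∂(volume.restrict (Set.Ici t₀)),
    deriv v t + a t * v (g t) + b t * x (h t) = 0

/-- (Uniform) exponential stability of `x''(t) + a(t) x'(g(t)) + b(t) x(h(t)) = 0`: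
there are `M, μ > 0` such that for every initial time `t₀ ≥ 0`, all bounded Borel measurable
past data `φ, ψ` and all initial values `x₀, x₀'`, the solution satisfies
`|x(t)| ≤ M e^{-μ (t - t₀)} (|x₀| + |x₀'| + sup_{s < t₀} (|φ(s)| + |ψ(s)|))` for `t ≥ t₀`. -/
def ExponentiallyStable (a b g h : ℝ → ℝ) : Prop :=
  ∃ M μ : ℝ, 0 < M ∧ 0 < μ ∧
    ∀ t₀ : ℝ, 0 ≤ t₀ →
    ∀ φ ψ : Set.Iio t₀ → ℝ, Measurable φ → Measurable ψ →
      (∃ C, ∀ s, |φ s| ≤ C) → (∃ C, ∀ s, |ψ s| ≤ C) →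
    ∀ (x₀ x₀' : ℝ) (x v : ℝ → ℝ), IsSolution a b g h t₀ φ ψ x₀ x₀' x v →
    ∀ t, t₀ ≤ t →
      |x t| ≤ M * Real.exp (-μ * (t - t₀)) *
        (|x₀| + |x₀'| + ⨆ s : Set.Iio t₀, (|φ s| + |ψ s|))

/-- The norm of `f` in `L_∞[T, ∞)`, as a real number. -/
noncomputable def normLinfty (T : ℝ) (f : ℝ → ℝ) : ℝ :=
  (eLpNorm f ⊤ (volume.restrict (Set.Ici T))).toReal

/-- The essential infimum of `f` on `[T, ∞)`. -/
noncomputable def essInfFrom (T : ℝ) (f : ℝ → ℝ) : ℝ :=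
  essInf f (volume.restrict (Set.Ici T))

/-- The essential supremum of `f` on `[T, ∞)`. -/
noncomputable def essSupFrom (T : ℝ) (f : ℝ → ℝ) : ℝ :=
  essSup f (volume.restrict (Set.Ici T))

end SecondOrderDelay

namespace SecondOrderDelay

open Set

/-! The proof is a chain of sup-norm estimates. Write `w = x'` and let `m` bound `|x|`; terms from
the history and from errors are omitted here.

Velocity: `w' + a w(g) = -b x(h)` is a first order equation with forcing at most `‖b/a‖ m a`. The
`1/e` condition yields `|w| ≤ ‖b/a‖ m` (`abs_le_of_delay_first_order`, `abs_velocity_le`): a bound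
`ρ` of the defect `w' + e a w` relative to `e a` controls `w` over one delay, and inserting this
into the equation contracts `ρ` towards the bound of the forcing.

Removing the delays: now `|x''| ≤ (‖a‖ ‖b/a‖ + ‖b‖) m`, so replacing `g(t)` and `h(t)` by `t` gives
`x'' + a x' + b x = F` with `|F| ≤ κ m b`, where `κ < 1` is the left side of the main hypothesis.

Undelayed equation: let `l` be half the essential infimum of `a`, so that `a ≥ 2l` and `b ≤ l²`.
Then `z = x' + l x` satisfies `z' + (a - l) z = F + (l (a - l) - b) x` with a nonnegative
coefficient of `x`. Two scalar maximum principles, for `z` and then for `x`, improve `m` by a fixed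
factor. Since `m` may be taken to be an attained maximum, history and error bound it
(`exists_uniform_bound`).

Decay: `e^{μ (t - T)} x` solves the equation up to an error that is a small multiple of its own norm
plus a bound of the history. For small `μ` the uniform bound absorbs that multiple. Up to the time
`T`, a crude growth estimate suffices. -/

/-! ### Absolutely continuous functions and scalar differential inequalities. -/

theorem _root_.LipschitzOnWith.comp_absolutelyContinuousOnInterval {φ f : ℝ → ℝ} {K : NNReal}
    {s : Set ℝ} {a b : ℝ} (hφ : LipschitzOnWith K φ s) (hf : AbsolutelyContinuousOnInterval f a b)
    (hs : MapsTo f (uIcc a b) s) : AbsolutelyContinuousOnInterval (fun t => φ (f t)) a b := by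
  rw [absolutelyContinuousOnInterval_iff] at hf ⊢
  intro ε hε
  obtain ⟨η, hη, h⟩ := hf (ε / (K + 1)) (by positivity)
  refine ⟨η, hη, fun E hE hE' => ?_⟩
  have h1 := h E hE hE'
  have hle : ∑ i ∈ Finset.range E.1, dist (φ (f (E.2 i).1)) (φ (f (E.2 i).2)) ≤
      K * ∑ i ∈ Finset.range E.1, dist (f (E.2 i).1) (f (E.2 i).2) := by
    rw [Finset.mul_sum]
    exact Finset.sum_le_sum fun i hi =>
      hφ.dist_le_mul _ (hs (hE.1 i hi).1) _ (hs (hE.1 i hi).2)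
  have h0 : 0 ≤ ∑ i ∈ Finset.range E.1, dist (f (E.2 i).1) (f (E.2 i).2) :=
    Finset.sum_nonneg fun _ _ => dist_nonneg
  calc _ ≤ _ := hle
    _ ≤ (K + 1) * ∑ i ∈ Finset.range E.1, dist (f (E.2 i).1) (f (E.2 i).2) := by
        gcongr; linarith
    _ < (K + 1) * (ε / (K + 1)) := by gcongr
    _ = ε := by field_simp

theorem _root_.AbsolutelyContinuousOnInterval.exp {f : ℝ → ℝ} {a b : ℝ}
    (hf : AbsolutelyContinuousOnInterval f a b) :
    AbsolutelyContinuousOnInterval (fun t => Real.exp (f t)) a b := by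
  obtain ⟨C, hC⟩ := hf.exists_bound
  have hcd : ContDiffOn ℝ 1 Real.exp (Icc (-C) C) := Real.contDiff_exp.contDiffOn
  obtain ⟨K, hK⟩ := hcd.exists_lipschitzOnWith (by decide) (convex_Icc _ _) isCompact_Icc
  exact hK.comp_absolutelyContinuousOnInterval hf fun x hx => abs_le.1 (hC x hx)

theorem _root_.AbsolutelyContinuousOnInterval.mono_Icc {f : ℝ → ℝ} {a b s t : ℝ}
    (hf : AbsolutelyContinuousOnInterval f a b) (has : a ≤ s) (hst : s ≤ t) (htb : t ≤ b) :
    AbsolutelyContinuousOnInterval f s t := by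
  refine hf.mono ?_
  rw [uIcc_of_le hst, uIcc_of_le (has.trans (hst.trans htb))]
  exact Icc_subset_Icc has htb

theorem absolutelyContinuous_const (c s t : ℝ) :
    AbsolutelyContinuousOnInterval (fun _ => c) s t :=
  (contDiff_const.contDiffOn (n := 1)).absolutelyContinuousOnInterval

/-- An absolutely continuous function with nonpositive derivative does not increase. -/
theorem sub_nonpos_of_ae_deriv_nonpos {f : ℝ → ℝ} {s t : ℝ} (hst : s ≤ t)
    (hf : AbsolutelyContinuousOnInterval f s t)
    (h : ∀ᵐ r, r ∈ Ioc s t → deriv f r ≤ 0) : f t - f s ≤ 0 := by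
  rw [← hf.integral_deriv_eq_sub, intervalIntegral.integral_of_le hst]
  exact integral_nonpos_of_ae ((ae_restrict_iff' measurableSet_Ioc).2 h)

/-- Comparison of increments: `|f'| ≤ k'` almost everywhere implies `|f t - f s| ≤ k t - k s`. -/
theorem abs_sub_le_of_ae_abs_deriv_le {f k : ℝ → ℝ} {s t : ℝ} (hst : s ≤ t)
    (hf : AbsolutelyContinuousOnInterval f s t) (hk : AbsolutelyContinuousOnInterval k s t)
    (h : ∀ᵐ r, r ∈ Icc s t → |deriv f r| ≤ deriv k r) : |f t - f s| ≤ k t - k s := by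
  have hu : uIcc s t = Icc s t := uIcc_of_le hst
  have h1 := sub_nonpos_of_ae_deriv_nonpos hst (hf.sub hk) (by
    filter_upwards [h, hf.ae_differentiableAt, hk.ae_differentiableAt] with r hr h1 h2 hrs
    have hrs' := Ioc_subset_Icc_self hrs
    rw [deriv_sub (h1 (hu ▸ hrs')) (h2 (hu ▸ hrs'))]
    linarith [(abs_le.1 (hr hrs')).2])
  have h2 := sub_nonpos_of_ae_deriv_nonpos hst (hf.neg.sub hk) (by
    filter_upwards [h, hf.ae_differentiableAt, hk.ae_differentiableAt] with r hr h1 h2 hrs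
    have hrs' := Ioc_subset_Icc_self hrs
    rw [deriv_sub (h1 (hu ▸ hrs')).neg (h2 (hu ▸ hrs')), deriv.neg]
    linarith [(abs_le.1 (hr hrs')).1])
  simp only [Pi.sub_apply, Pi.neg_apply] at h1 h2
  rw [abs_le]
  constructor <;> linarith

theorem abs_sub_le_mul_of_ae_abs_deriv_le {f : ℝ → ℝ} {s t K : ℝ} (hst : s ≤ t)
    (hf : AbsolutelyContinuousOnInterval f s t)
    (h : ∀ᵐ r, r ∈ Icc s t → |deriv f r| ≤ K) : |f t - f s| ≤ K * (t - s) := by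
  have hk : AbsolutelyContinuousOnInterval (fun r => K * r) s t :=
    (contDiff_const.mul contDiff_id).contDiffOn.absolutelyContinuousOnInterval
  have := abs_sub_le_of_ae_abs_deriv_le hst hf hk (by
    filter_upwards [h] with r hr hrs
    rw [deriv_const_mul_id']
    exact hr hrs)
  linarith

/-- A one-sided maximum principle for absolutely continuous functions. -/
theorem nonpos_of_ae_deriv_nonpos_of_pos {f : ℝ → ℝ} {T R : ℝ}
    (hf : AbsolutelyContinuousOnInterval f T R) (h0 : f T ≤ 0)
    (h : ∀ᵐ r, r ∈ Icc T R → 0 < f r → deriv f r ≤ 0) : ∀ t ∈ Icc T R, f t ≤ 0 := by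
  intro t ht
  by_contra! hpos
  have hfc : ContinuousOn f (Icc T t) :=
    (hf.mono_Icc le_rfl ht.1 ht.2).continuousOn.mono (by rw [uIcc_of_le ht.1])
  set S : Set ℝ := Icc T t ∩ f ⁻¹' Iic 0 with hS
  have hSc : IsCompact S :=
    (isCompact_Icc (a := T) (b := t)).of_isClosed_subset
      (hfc.preimage_isClosed_of_isClosed isClosed_Icc isClosed_Iic) inter_subset_left
  have hSn : S.Nonempty := ⟨T, ⟨le_rfl, ht.1⟩, h0⟩
  -- The last time before `t` at which `f ≤ 0`: after it `f` is positive, hence cannot increase.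
  obtain ⟨s, hs⟩ := hSc.exists_isGreatest hSn
  have hsm := hs.1
  have hd := sub_nonpos_of_ae_deriv_nonpos hsm.1.2 (hf.mono_Icc hsm.1.1 hsm.1.2 ht.2) (by
    filter_upwards [h] with r hr hrs
    refine hr ⟨hsm.1.1.trans hrs.1.le, hrs.2.trans ht.2⟩ ?_
    by_contra! hle
    exact absurd (hs.2 (show r ∈ S from ⟨⟨hsm.1.1.trans hrs.1.le, hrs.2⟩, hle⟩)) (not_le.2 hrs.1))
  have : f s ≤ 0 := hsm.2
  linarith

/-- A dissipative scalar equation `u' = -q u + G` with `|G| ≤ q N` keeps `[-N, N]` invariant. -/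
theorem abs_le_of_ae_abs_deriv_add_mul_le {u q : ℝ → ℝ} {T R N : ℝ}
    (hu : AbsolutelyContinuousOnInterval u T R) (hT : |u T| ≤ N)
    (hq : ∀ᵐ t, t ∈ Icc T R → 0 ≤ q t)
    (h : ∀ᵐ t, t ∈ Icc T R → |deriv u t + q t * u t| ≤ q t * N) :
    ∀ t ∈ Icc T R, |u t| ≤ N := by
  intro t ht
  have hc := absolutelyContinuous_const N T R
  have h1 := nonpos_of_ae_deriv_nonpos_of_pos (hu.fun_sub hc)
    (by linarith [(abs_le.1 hT).2]) (by
    filter_upwards [hq, h] with r hq h hr hpos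
    rw [deriv_sub_const]
    nlinarith [(abs_le.1 (h hr)).2, mul_nonneg (hq hr) hpos.le]) t ht
  have h2 := nonpos_of_ae_deriv_nonpos_of_pos (hu.fun_neg.fun_sub hc)
    (by linarith [(abs_le.1 hT).1]) (by
    filter_upwards [hq, h] with r hq h hr hpos
    rw [deriv_sub_const, deriv.fun_neg]
    nlinarith [(abs_le.1 (h hr)).1, mul_nonneg (hq hr) hpos.le]) t ht
  rw [abs_le]
  constructor <;> linarith

/-! ### The first order delay equation under the `1/e` condition. -/

/-- If `|w' + c w| ≤ ρ c`, then `ρ ± w` times the integrating factor of `c` is nondecreasing. -/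
theorem abs_mul_exp_sub_le {c w : ℝ → ℝ} {T R ρ s t : ℝ}
    (hc : IntervalIntegrable c volume T R) (hw : AbsolutelyContinuousOnInterval w T R)
    (h : ∀ᵐ r, r ∈ Icc T R → |deriv w r + c r * w r| ≤ ρ * c r)
    (hTs : T ≤ s) (hst : s ≤ t) (htR : t ≤ R) :
    |w t * Real.exp (∫ r in s..t, c r) - w s| ≤ ρ * (Real.exp (∫ r in s..t, c r) - 1) := by
  have hsR := hst.trans htR
  have huTR : uIcc T R = Icc T R := uIcc_of_le (hTs.trans hsR)
  have hcs : ∀ r ∈ Icc s t, IntervalIntegrable c volume s r := fun r hr =>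
    hc.mono_set (by
      rw [uIcc_of_le hr.1, huTR]; exact Icc_subset_Icc hTs (hr.2.trans htR))
  have hst' := hcs t ⟨hst, le_rfl⟩
  set X : ℝ → ℝ := fun r => Real.exp (∫ r in s..r, c r) with hX
  have hXac : AbsolutelyContinuousOnInterval X s t :=
    (hst'.absolutelyContinuousOnInterval_intervalIntegral left_mem_uIcc).exp
  have hws := hw.mono_Icc hTs hst htR
  have hust : uIcc s t = Icc s t := uIcc_of_le hst
  have key := abs_sub_le_of_ae_abs_deriv_le hst (hws.fun_mul hXac) (hXac.const_mul ρ) (by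
    filter_upwards [h, hws.ae_differentiableAt, hst'.ae_hasDerivAt_integral]
      with r hr hwr hcr hrs
    have hrs' : r ∈ uIcc s t := hust ▸ hrs
    have hXd : HasDerivAt X (X r * c r) r := (hcr hrs' s left_mem_uIcc).exp
    rw [((hwr hrs').hasDerivAt.fun_mul hXd).deriv, (hXd.const_mul ρ).deriv]
    have hXpos : 0 < X r := Real.exp_pos _
    have e1 : deriv w r * X r + w r * (X r * c r) = X r * (deriv w r + c r * w r) := by ring
    have e2 : ρ * (X r * c r) = X r * (ρ * c r) := by ring
    rw [e1, e2, abs_mul, abs_of_pos hXpos]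
    exact mul_le_mul_of_nonneg_left (hr ⟨hTs.trans hrs.1, hrs.2.trans htR⟩) hXpos.le)
  have hXs : X s = 1 := by simp [hX]
  rw [hXs] at key
  calc _ = |w t * X t - w s * 1| := by rw [mul_one]
    _ ≤ ρ * X t - ρ * 1 := key
    _ = _ := by ring

/-- A contraction step for `w' + a w(g) = G`, in terms of the defect `w' + e a w`. -/
theorem defect_improvement {a g w : ℝ → ℝ} {T' T R N ρ₀ ρ : ℝ}
    (ha : IntervalIntegrable a volume T' R)
    (hapos : ∀ᵐ t, t ∈ Icc T' R → 0 < a t)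
    (hg : ∀ t ∈ Icc T R, T' ≤ g t ∧ g t ≤ t)
    (hint : ∀ t ∈ Icc T R, ∫ s in (g t)..t, a s ≤ 1 / Real.exp 1)
    (hw : AbsolutelyContinuousOnInterval w T' R)
    (hist : |w T'| ≤ ρ₀)
    (histd : ∀ᵐ t, t ∈ Icc T' T →
      |deriv w t + Real.exp 1 * a t * w t| ≤ ρ₀ * (Real.exp 1 * a t))
    (heq : ∀ᵐ t, t ∈ Icc T R → |deriv w t + a t * w (g t)| ≤ N * a t)
    (hN : N ≤ ρ₀) (hρ : ρ₀ ≤ ρ)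
    (hd : ∀ᵐ t, t ∈ Icc T' R →
      |deriv w t + Real.exp 1 * a t * w t| ≤ ρ * (Real.exp 1 * a t)) :
    (∀ t ∈ Icc T' R, |w t| ≤ ρ) ∧
    ∀ᵐ t, t ∈ Icc T' R → |deriv w t + Real.exp 1 * a t * w t| ≤
      (ρ₀ + (1 - 1 / Real.exp 1) * (ρ - ρ₀)) * (Real.exp 1 * a t) := by
  have he : 0 < Real.exp 1 := Real.exp_pos 1
  have he1 : 1 ≤ Real.exp 1 := Real.one_le_exp zero_le_one
  have hinv : 1 / Real.exp 1 ≤ 1 := by rw [div_le_one he]; exact he1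
  have hinc := fun s t h1 h2 h3 =>
    abs_mul_exp_sub_le (s := s) (t := t) (ha.const_mul (Real.exp 1)) hw hd h1 h2 h3
  have hExp : ∀ s t, T' ≤ s → s ≤ t → t ≤ R → 1 ≤ Real.exp (∫ r in s..t, Real.exp 1 * a r) := by
    intro s t h1 h2 h3
    refine Real.one_le_exp (intervalIntegral.integral_nonneg_of_ae_restrict h2 ?_)
    rw [Filter.EventuallyLE, ae_restrict_iff' measurableSet_Icc]
    filter_upwards [hapos] with r hr hrs
    exact mul_nonneg he.le (hr ⟨h1.trans hrs.1, hrs.2.trans h3⟩).le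
  have hwρ : ∀ t ∈ Icc T' R, |w t| ≤ ρ := by
    intro t ht
    have h1 := hinc T' t le_rfl ht.1 ht.2
    have h2 := hExp T' t le_rfl ht.1 ht.2
    set X := Real.exp (∫ r in T'..t, Real.exp 1 * a r)
    have h3 : |w t| * X ≤ ρ * X := by
      have : |w t * X| = |w t| * X := by rw [abs_mul, abs_of_pos (by linarith : 0 < X)]
      rw [← this]
      calc |w t * X| = |(w t * X - w T') + w T'| := by ring_nf
        _ ≤ |w t * X - w T'| + |w T'| := abs_add_le _ _
        _ ≤ ρ * (X - 1) + ρ₀ := add_le_add h1 hist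
        _ ≤ ρ * X := by linarith
    exact le_of_mul_le_mul_right h3 (by linarith)
  refine ⟨hwρ, ?_⟩
  filter_upwards [hapos, histd, heq] with t hat hht het ht
  have ha0 := hat ht
  rcases le_total t T with htT | htT
  · refine (hht ⟨ht.1, htT⟩).trans (mul_le_mul_of_nonneg_right ?_ (by positivity))
    have : 0 ≤ (1 - 1 / Real.exp 1) * (ρ - ρ₀) :=
      mul_nonneg (by linarith) (by linarith)
    linarith
  · have htm : t ∈ Icc T R := ⟨htT, ht.2⟩
    obtain ⟨hg1, hg2⟩ := hg t htm
    have h1 := hinc (g t) t hg1 hg2 ht.2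
    have h2 := hExp (g t) t hg1 hg2 ht.2
    -- The `1/e` condition enters here: it makes `e - X` nonnegative below.
    have h3 : Real.exp (∫ r in (g t)..t, Real.exp 1 * a r) ≤ Real.exp 1 := by
      rw [Real.exp_le_exp, intervalIntegral.integral_const_mul]
      calc _ ≤ Real.exp 1 * (1 / Real.exp 1) := mul_le_mul_of_nonneg_left (hint t htm) he.le
        _ = 1 := by field_simp
    set X := Real.exp (∫ r in (g t)..t, Real.exp 1 * a r)
    have h4 := het htm
    have h5 := hwρ t ht
    -- The terms are at most `N a`, `ρ (X - 1) a` and `ρ (e - X) a`. The unknown `X` cancels,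
    -- leaving `(N + (e - 1) ρ) a`, which is a contraction with factor `1 - 1/e` relative to `e a`.
    have e1 : deriv w t + Real.exp 1 * a t * w t = (deriv w t + a t * w (g t)) +
        (a t * (w t * X - w (g t)) + a t * (Real.exp 1 - X) * w t) := by ring
    rw [e1]
    calc _ ≤ |deriv w t + a t * w (g t)| +
          (|a t * (w t * X - w (g t))| + |a t * (Real.exp 1 - X) * w t|) :=
          (abs_add_le _ _).trans (add_le_add_right (abs_add_le _ _) _)
      _ ≤ N * a t + (a t * (ρ * (X - 1)) + a t * (Real.exp 1 - X) * ρ) := by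
          have h6 : |a t * (Real.exp 1 - X) * w t| ≤ a t * (Real.exp 1 - X) * ρ := by
            rw [abs_mul, abs_of_nonneg (mul_nonneg ha0.le (by linarith : 0 ≤ Real.exp 1 - X))]
            exact mul_le_mul_of_nonneg_left h5 (mul_nonneg ha0.le (by linarith))
          have h7 : |a t * (w t * X - w (g t))| ≤ a t * (ρ * (X - 1)) := by
            rw [abs_mul, abs_of_pos ha0]
            exact mul_le_mul_of_nonneg_left h1 ha0.le
          linarith
      _ = (N + (Real.exp 1 - 1) * ρ) * a t := by ring
      _ ≤ (ρ₀ + (Real.exp 1 - 1) * ρ) * a t := by gcongr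
      _ = _ := by field_simp; ring

/-- The scalar equation `w' + a w(g) = G` with `∫_g^t a ≤ 1 / e` and `|G| ≤ N a`: the bound `N`
is not exceeded, provided that the history does not exceed it. -/
theorem abs_le_of_delay_first_order {a g w : ℝ → ℝ} {T' T R N ρ₀ ρ : ℝ}
    (ha : IntervalIntegrable a volume T' R)
    (hapos : ∀ᵐ t, t ∈ Icc T' R → 0 < a t)
    (hg : ∀ t ∈ Icc T R, T' ≤ g t ∧ g t ≤ t)
    (hint : ∀ t ∈ Icc T R, ∫ s in (g t)..t, a s ≤ 1 / Real.exp 1)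
    (hw : AbsolutelyContinuousOnInterval w T' R)
    (hist : |w T'| ≤ ρ₀)
    (histd : ∀ᵐ t, t ∈ Icc T' T →
      |deriv w t + Real.exp 1 * a t * w t| ≤ ρ₀ * (Real.exp 1 * a t))
    (heq : ∀ᵐ t, t ∈ Icc T R → |deriv w t + a t * w (g t)| ≤ N * a t)
    (hN : N ≤ ρ₀)
    (hd : ∀ᵐ t, t ∈ Icc T' R →
      |deriv w t + Real.exp 1 * a t * w t| ≤ ρ * (Real.exp 1 * a t)) :
    ∀ t ∈ Icc T' R, |w t| ≤ ρ₀ := by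
  have he : 0 < Real.exp 1 := Real.exp_pos 1
  have he1 : 1 ≤ Real.exp 1 := Real.one_le_exp zero_le_one
  have hinv : 1 / Real.exp 1 ≤ 1 := by rw [div_le_one he]; exact he1
  have hinv0 : 0 < 1 / Real.exp 1 := by positivity
  set θ := 1 - 1 / Real.exp 1 with hθ
  set D := max (ρ - ρ₀) 0 with hD
  have hDn : 0 ≤ D := le_max_right _ _
  have hpow : ∀ n : ℕ, 0 ≤ θ ^ n * D := fun n =>
    mul_nonneg (pow_nonneg (by linarith) n) hDn
  have hstep : ∀ n : ℕ, ∀ᵐ t, t ∈ Icc T' R →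
      |deriv w t + Real.exp 1 * a t * w t| ≤ (ρ₀ + θ ^ n * D) * (Real.exp 1 * a t) := by
    intro n
    induction n with
    | zero =>
      filter_upwards [hd, hapos] with t h1 h2 ht
      refine (h1 ht).trans (mul_le_mul_of_nonneg_right ?_ (mul_pos he (h2 ht)).le)
      rw [pow_zero, one_mul]
      linarith [le_max_left (ρ - ρ₀) 0]
    | succ n ih =>
      have := (defect_improvement ha hapos hg hint hw hist histd heq hN
        (by linarith [hpow n]) ih).2
      filter_upwards [this] with t h1 ht
      refine (h1 ht).trans (le_of_eq ?_)
      rw [pow_succ, ← hθ]; ring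
  intro t ht
  -- The a priori constant `ρ` only starts the iteration and disappears in the limit.
  have hlim : Filter.Tendsto (fun n : ℕ => ρ₀ + θ ^ n * D) Filter.atTop (nhds (ρ₀ + 0 * D)) :=
    ((tendsto_pow_atTop_nhds_zero_of_lt_one (by linarith) (by linarith)).mul_const D).const_add ρ₀
  rw [zero_mul, add_zero] at hlim
  exact ge_of_tendsto' hlim fun n =>
    (defect_improvement ha hapos hg hint hw hist histd heq hN
        (by linarith [hpow n]) (hstep n)).1 t ht

/-! ### A priori estimates for approximate solutions. -/

/-- Quantitative form, on `[s, ∞)`, of the hypotheses on the coefficients and delays. -/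
structure CoefficientBounds (a b g h : ℝ → ℝ) (s δ τ l b₀ A B α β : ℝ) : Prop where
  l_pos : 0 < l
  b₀_pos : 0 < b₀
  l_le : 2 * l ≤ A
  b₀_le : b₀ ≤ l ^ 2
  B_nonneg : 0 ≤ B
  α_nonneg : 0 ≤ α
  β_nonneg : 0 ≤ β
  δ_nonneg : 0 ≤ δ
  τ_nonneg : 0 ≤ τ
  le_a : ∀ᵐ t, s ≤ t → 2 * l ≤ a t
  a_le : ∀ᵐ t, s ≤ t → a t ≤ A
  le_b : ∀ᵐ t, s ≤ t → b₀ ≤ b t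
  b_le : ∀ᵐ t, s ≤ t → b t ≤ B
  b_le_sq : ∀ᵐ t, s ≤ t → b t ≤ l ^ 2
  a_le_b : ∀ᵐ t, s ≤ t → a t ≤ α * b t
  b_le_a : ∀ᵐ t, s ≤ t → b t ≤ β * a t
  a_int : ∀ t, s ≤ t → ∀ t', t ≤ t' → IntervalIntegrable a volume t t'
  g_mem : ∀ t, s ≤ t → t - δ ≤ g t ∧ g t ≤ t
  h_mem : ∀ t, s ≤ t → t - τ ≤ h t ∧ h t ≤ t
  integral_le : ∀ t, s ≤ t → ∫ r in (g t)..t, a r ≤ 1 / Real.exp 1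
  contraction : δ * α * (A * β + B) + τ * β < 1

/-- `(y, w)` solves the first order system with an error `E`, and has a history bounded by `E`. -/
structure IsApproxSolution (a b g h : ℝ → ℝ) (σ T R E : ℝ) (y w : ℝ → ℝ) : Prop where
  le : T ≤ R
  E_nonneg : 0 ≤ E
  ac_y : AbsolutelyContinuousOnInterval y (T - 2 * σ) R
  ac_w : AbsolutelyContinuousOnInterval w (T - 2 * σ) R
  past_y : ∀ t ∈ Icc (T - 2 * σ) T, |y t| ≤ E
  past_w : ∀ t ∈ Icc (T - 2 * σ) T, |w t| ≤ E
  deriv_y : ∀ᵐ t, t ∈ Icc (T - 2 * σ) R → |deriv y t - w t| ≤ E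
  deriv_w : ∀ᵐ t, t ∈ Icc (T - σ) R → |deriv w t + a t * w (g t) + b t * y (h t)| ≤ E

section

variable {a b g h : ℝ → ℝ} {s δ τ l b₀ A B α β T R E : ℝ} {y w : ℝ → ℝ}

/-- The term `b y(h)` is at most `β m a`, and since `a ≥ 2l` an error `E` is at most `(E / (2l)) a`;
thus the whole forcing is measured against `a`, as the first order estimate requires. -/
theorem abs_velocity_le (H : CoefficientBounds a b g h s δ τ l b₀ A B α β)
    (hT : s + 2 * (δ + τ) ≤ T) (S : IsApproxSolution a b g h (δ + τ) T R E y w) {m : ℝ}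
    (hm : ∀ t ∈ Icc (T - 2 * (δ + τ)) R, |y t| ≤ m) :
    ∀ t ∈ Icc (T - 2 * (δ + τ)) R, |w t| ≤ β * m + (1 + (1 + A + B) / (2 * l)) * E := by
  have hδ := H.δ_nonneg
  have hτ := H.τ_nonneg
  have hl := H.l_pos
  have hE := S.E_nonneg
  have hTR := S.le
  have hβ := H.β_nonneg
  have hA : 0 < A := by linarith [H.l_le]
  have hB := H.B_nonneg
  have he : 0 < Real.exp 1 := Real.exp_pos 1
  have he1 : 1 ≤ Real.exp 1 := Real.one_le_exp zero_le_one
  set σ := δ + τ with hσ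
  have hTm : T ∈ Icc (T - 2 * σ) R := ⟨by linarith, hTR⟩
  have hm0 : 0 ≤ m := (abs_nonneg _).trans (hm T hTm)
  have hβm : 0 ≤ β * m := mul_nonneg hβ hm0
  set c := (1 + A + B) / (2 * l) with hc
  have hc0 : 0 ≤ c := by positivity
  set N := β * m + E / (2 * l) with hN
  have hEl : 0 ≤ E / (2 * l) := by positivity
  set ρ₀ := β * m + (1 + c) * E with hρ₀
  have hcE : E / (2 * l) ≤ c * E := by
    rw [hc, div_mul_eq_mul_div]
    gcongr
    nlinarith
  have hEρ : E ≤ ρ₀ := by nlinarith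
  obtain ⟨Wm, hWm⟩ := S.ac_w.exists_bound
  rw [uIcc_of_le (by linarith)] at hWm
  simp only [Real.norm_eq_abs] at hWm
  have hWm0 : 0 ≤ Wm := (abs_nonneg _).trans (hWm T hTm)
  have hgm : ∀ t ∈ Icc (T - σ) R, T - 2 * σ ≤ g t ∧ g t ≤ t := fun t ht => by
    have := H.g_mem t (by linarith [ht.1])
    exact ⟨by linarith [ht.1], this.2⟩
  have hhm : ∀ t ∈ Icc (T - σ) R, T - 2 * σ ≤ h t ∧ h t ≤ t := fun t ht => by
    have := H.h_mem t (by linarith [ht.1])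
    exact ⟨by linarith [ht.1], this.2⟩
  have heq : ∀ᵐ t, t ∈ Icc (T - σ) R → |deriv w t + a t * w (g t)| ≤ N * a t := by
    filter_upwards [S.deriv_w, H.le_a, H.le_b, H.b_le_a] with t h1 h2 h3 h4 ht
    have hst : s ≤ t := by linarith [ht.1]
    have h2 := h2 hst
    have h3 := h3 hst
    have h4 := h4 hst
    have h5 := hm (h t) ⟨(hhm t ht).1, (hhm t ht).2.trans ht.2⟩
    have hb : 0 < b t := H.b₀_pos.trans_le h3
    have h6 : |b t * y (h t)| ≤ β * a t * m := by
      rw [abs_mul, abs_of_pos hb]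
      exact mul_le_mul h4 h5 (abs_nonneg _) (hb.le.trans h4)
    have h7 : E ≤ E / (2 * l) * a t := by
      rw [div_mul_eq_mul_div, le_div_iff₀ (by positivity)]
      exact mul_le_mul_of_nonneg_left h2 hE
    calc |deriv w t + a t * w (g t)|
        = |(deriv w t + a t * w (g t) + b t * y (h t)) - b t * y (h t)| := by ring_nf
      _ ≤ |deriv w t + a t * w (g t) + b t * y (h t)| + |b t * y (h t)| := abs_sub _ _
      _ ≤ E / (2 * l) * a t + β * a t * m := add_le_add ((h1 ht).trans h7) h6
      _ = N * a t := by rw [hN]; ring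
  -- The equation is available only from `T - σ` on, and `g` maps `[T, R]` above that point. The
  -- value of `ρ` is any finite bound of the defect, obtained from the maximum `Wm` of `|w|`.
  have key := abs_le_of_delay_first_order (T' := T - σ) (T := T) (ρ₀ := ρ₀) (N := N)
    (ρ := N + Wm + Real.exp 1 * Wm)
    (H.a_int _ (by linarith) _ (by linarith))
    (by
      filter_upwards [H.le_a] with t h1 ht
      linarith [h1 (by linarith [ht.1])])
    (fun t ht => by
      have := H.g_mem t (by linarith [ht.1])
      exact ⟨by linarith [ht.1], this.2⟩)
    (fun t ht => H.integral_le t (by linarith [ht.1]))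
    (S.ac_w.mono_Icc (by linarith) (by linarith) le_rfl)
    ((S.past_w _ ⟨by linarith, by linarith⟩).trans hEρ)
    (by
      filter_upwards [S.deriv_w, H.le_a, H.a_le, H.le_b, H.b_le] with t h1 h2 h3 h4 h5 ht
      have hst : s ≤ t := by linarith [ht.1]
      have h2 := h2 hst
      have h3 := h3 hst
      have h4 := h4 hst
      have h5 := h5 hst
      have htR : t ∈ Icc (T - σ) R := ⟨ht.1, ht.2.trans hTR⟩
      have hb : 0 < b t := H.b₀_pos.trans_le h4
      have ha : 0 < a t := by linarith
      have h6 := S.past_y (h t) ⟨(hhm t htR).1, (hhm t htR).2.trans ht.2⟩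
      have h7 := S.past_w (g t) ⟨(hgm t htR).1, (hgm t htR).2.trans ht.2⟩
      have h8 := S.past_w t ⟨by linarith [ht.1], ht.2⟩
      have h9 : |a t * w (g t)| ≤ A * E := by
        rw [abs_mul, abs_of_pos ha]
        exact mul_le_mul h3 h7 (abs_nonneg _) hA.le
      have h10 : |b t * y (h t)| ≤ B * E := by
        rw [abs_mul, abs_of_pos hb]
        exact mul_le_mul h5 h6 (abs_nonneg _) hB
      have h11 : |Real.exp 1 * a t * w t| ≤ Real.exp 1 * a t * E := by
        rw [abs_mul, abs_of_pos (mul_pos he ha)]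
        exact mul_le_mul_of_nonneg_left h8 (mul_pos he ha).le
      -- On the history the defect is at most `(1 + A + B) E + e a E`; this choice of `c` absorbs
      -- the first part by means of `e a ≥ 2l`.
      have h12 : (1 + A + B) * E ≤ c * E * (Real.exp 1 * a t) := by
        have : 2 * l ≤ Real.exp 1 * a t := by nlinarith
        calc (1 + A + B) * E = c * E * (2 * l) := by rw [hc]; field_simp
          _ ≤ _ := mul_le_mul_of_nonneg_left this (by positivity)
      have h13 : 0 ≤ β * m * (Real.exp 1 * a t) := by positivity
      calc |deriv w t + Real.exp 1 * a t * w t|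
          = |((deriv w t + a t * w (g t) + b t * y (h t)) + Real.exp 1 * a t * w t) -
              (a t * w (g t) + b t * y (h t))| := by ring_nf
        _ ≤ |(deriv w t + a t * w (g t) + b t * y (h t)) + Real.exp 1 * a t * w t| +
              |a t * w (g t) + b t * y (h t)| := abs_sub _ _
        _ ≤ (|deriv w t + a t * w (g t) + b t * y (h t)| + |Real.exp 1 * a t * w t|) +
              (|a t * w (g t)| + |b t * y (h t)|) :=
            add_le_add (abs_add_le _ _) (abs_add_le _ _)
        _ ≤ (E + Real.exp 1 * a t * E) + (A * E + B * E) := by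
            linarith [h1 htR]
        _ ≤ ρ₀ * (Real.exp 1 * a t) := by rw [hρ₀]; nlinarith)
    (by
      filter_upwards [heq] with t h1 ht
      exact h1 ⟨by linarith [ht.1], ht.2⟩)
    (by rw [hN, hρ₀]; linarith)
    (by
      filter_upwards [heq, H.le_a] with t h1 h2 ht
      have ha : 0 < a t := by linarith [h2 (by linarith [ht.1])]
      have h3 := hWm (g t) ⟨(hgm t ht).1, (hgm t ht).2.trans ht.2⟩
      have h4 := hWm t ⟨by linarith [ht.1], ht.2⟩
      have h5 : |a t * w (g t)| ≤ a t * Wm := by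
        rw [abs_mul, abs_of_pos ha]
        exact mul_le_mul_of_nonneg_left h3 ha.le
      have h6 : |Real.exp 1 * a t * w t| ≤ Real.exp 1 * a t * Wm := by
        rw [abs_mul, abs_of_pos (mul_pos he ha)]
        exact mul_le_mul_of_nonneg_left h4 (mul_pos he ha).le
      calc |deriv w t + Real.exp 1 * a t * w t|
          = |((deriv w t + a t * w (g t)) + Real.exp 1 * a t * w t) - a t * w (g t)| := by
            ring_nf
        _ ≤ |(deriv w t + a t * w (g t)) + Real.exp 1 * a t * w t| + |a t * w (g t)| :=
            abs_sub _ _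
        _ ≤ |deriv w t + a t * w (g t)| + |Real.exp 1 * a t * w t| + |a t * w (g t)| :=
            add_le_add_left (abs_add_le _ _) _
        _ ≤ (N + Wm + Real.exp 1 * Wm) * a t := by linarith [h1 ht]
        _ ≤ (N + Wm + Real.exp 1 * Wm) * (Real.exp 1 * a t) :=
            mul_le_mul_of_nonneg_left (by nlinarith) (by positivity))
  intro t ht
  rcases le_total t T with h1 | h1
  · exact (S.past_w t ⟨ht.1, h1⟩).trans hEρ
  · exact key t ⟨by linarith, ht.2⟩

end

section

variable {a b g h : ℝ → ℝ} {s δ τ l b₀ A B α β T R E : ℝ} {y w : ℝ → ℝ}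

/-- Starting at `T - (δ + τ)` rather than at `T` covers every interval `[g t, t]` with `t ≥ T`;
hence the history window of twice the total delay. -/
theorem ae_abs_acceleration_le (H : CoefficientBounds a b g h s δ τ l b₀ A B α β)
    (hT : s + 2 * (δ + τ) ≤ T) (S : IsApproxSolution a b g h (δ + τ) T R E y w) {m ρ : ℝ}
    (hm : ∀ t ∈ Icc (T - 2 * (δ + τ)) R, |y t| ≤ m)
    (hρ : ∀ t ∈ Icc (T - 2 * (δ + τ)) R, |w t| ≤ ρ) :
    ∀ᵐ t, t ∈ Icc (T - (δ + τ)) R → |deriv w t| ≤ A * ρ + B * m + E := by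
  have hδ := H.δ_nonneg
  have hτ := H.τ_nonneg
  have hl := H.l_pos
  have hA : 0 < A := by linarith [H.l_le]
  filter_upwards [S.deriv_w, H.le_a, H.a_le, H.le_b, H.b_le] with t h1 h2 h3 h4 h5 ht
  have hst : s ≤ t := by linarith [ht.1]
  have ha : 0 < a t := by linarith [h2 hst]
  have hb : 0 < b t := H.b₀_pos.trans_le (h4 hst)
  have hg := H.g_mem t hst
  have hh := H.h_mem t hst
  have h6 := hm (h t) ⟨by linarith [ht.1], hh.2.trans ht.2⟩
  have h7 := hρ (g t) ⟨by linarith [ht.1], hg.2.trans ht.2⟩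
  have h9 : |a t * w (g t)| ≤ A * ρ := by
    rw [abs_mul, abs_of_pos ha]
    exact mul_le_mul (h3 hst) h7 (abs_nonneg _) hA.le
  have h10 : |b t * y (h t)| ≤ B * m := by
    rw [abs_mul, abs_of_pos hb]
    exact mul_le_mul (h5 hst) h6 (abs_nonneg _) H.B_nonneg
  calc |deriv w t| = |(deriv w t + a t * w (g t) + b t * y (h t)) -
        (a t * w (g t) + b t * y (h t))| := by ring_nf
    _ ≤ |deriv w t + a t * w (g t) + b t * y (h t)| + |a t * w (g t) + b t * y (h t)| :=
        abs_sub _ _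
    _ ≤ |deriv w t + a t * w (g t) + b t * y (h t)| + (|a t * w (g t)| + |b t * y (h t)|) :=
        add_le_add_right (abs_add_le _ _) _
    _ ≤ A * ρ + B * m + E := by linarith [h1 ht]

/-- The defect of the equation without delays, relative to `b`. -/
theorem ae_abs_undelayed_defect_le (H : CoefficientBounds a b g h s δ τ l b₀ A B α β)
    (hT : s + 2 * (δ + τ) ≤ T) (S : IsApproxSolution a b g h (δ + τ) T R E y w) {m ρ : ℝ}
    (hm : ∀ t ∈ Icc (T - 2 * (δ + τ)) R, |y t| ≤ m)
    (hρ : ∀ t ∈ Icc (T - 2 * (δ + τ)) R, |w t| ≤ ρ) :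
    ∀ᵐ t, t ∈ Icc T R → |deriv w t + a t * w t + b t * y t| ≤
      b t * (δ * α * (A * ρ + B * m + E) + τ * (ρ + E) + E / b₀) := by
  have hδ := H.δ_nonneg
  have hτ := H.τ_nonneg
  have hl := H.l_pos
  have hE := S.E_nonneg
  have hTR := S.le
  have hb₀ := H.b₀_pos
  have hB := H.B_nonneg
  have hA : 0 < A := by linarith [H.l_le]
  have hTm : T ∈ Icc (T - 2 * (δ + τ)) R := ⟨by linarith, hTR⟩
  have hm0 : 0 ≤ m := (abs_nonneg _).trans (hm T hTm)
  have hρ0 : 0 ≤ ρ := (abs_nonneg _).trans (hρ T hTm)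
  have hacc := ae_abs_acceleration_le H hT S hm hρ
  have hvel : ∀ᵐ t, t ∈ Icc (T - 2 * (δ + τ)) R → |deriv y t| ≤ ρ + E := by
    filter_upwards [S.deriv_y] with t h1 ht
    calc |deriv y t| = |w t + (deriv y t - w t)| := by ring_nf
      _ ≤ |w t| + |deriv y t - w t| := abs_add_le _ _
      _ ≤ ρ + E := add_le_add (hρ t ht) (h1 ht)
  set V := A * ρ + B * m + E with hV
  have hV0 : 0 ≤ V := by positivity
  filter_upwards [S.deriv_w, H.le_a, H.le_b, H.a_le_b] with t h1 h2 h4 h5 ht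
  have hst : s ≤ t := by linarith [ht.1]
  have ha : 0 < a t := by linarith [h2 hst]
  have hb : 0 < b t := hb₀.trans_le (h4 hst)
  have hg := H.g_mem t hst
  have hh := H.h_mem t hst
  have h6 : |w t - w (g t)| ≤ V * (t - g t) := by
    refine abs_sub_le_mul_of_ae_abs_deriv_le hg.2
      (S.ac_w.mono_Icc (by linarith [ht.1]) hg.2 ht.2) ?_
    filter_upwards [hacc] with r hr hrt
    exact hr ⟨by linarith [ht.1, hrt.1], hrt.2.trans ht.2⟩
  have h7 : |y t - y (h t)| ≤ (ρ + E) * (t - h t) := by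
    refine abs_sub_le_mul_of_ae_abs_deriv_le hh.2
      (S.ac_y.mono_Icc (by linarith [ht.1]) hh.2 ht.2) ?_
    filter_upwards [hvel] with r hr hrt
    exact hr ⟨by linarith [ht.1, hrt.1], hrt.2.trans ht.2⟩
  have h8 : |a t * (w t - w (g t))| ≤ α * b t * (V * δ) := by
    rw [abs_mul, abs_of_pos ha]
    refine mul_le_mul (h5 hst) (h6.trans ?_) (abs_nonneg _) (ha.le.trans (h5 hst))
    exact mul_le_mul_of_nonneg_left (by linarith) hV0
  have h9 : |b t * (y t - y (h t))| ≤ b t * ((ρ + E) * τ) := by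
    rw [abs_mul, abs_of_pos hb]
    refine mul_le_mul_of_nonneg_left (h7.trans ?_) hb.le
    exact mul_le_mul_of_nonneg_left (by linarith) (by linarith)
  have h10 : E ≤ b t * (E / b₀) := by
    rw [mul_div_assoc', le_div_iff₀ hb₀, mul_comm]
    exact mul_le_mul_of_nonneg_right (h4 hst) hE
  have h11 := h1 ⟨by linarith [ht.1], ht.2⟩
  calc |deriv w t + a t * w t + b t * y t|
      = |(deriv w t + a t * w (g t) + b t * y (h t)) +
          (a t * (w t - w (g t)) + b t * (y t - y (h t)))| := by ring_nf
    _ ≤ |deriv w t + a t * w (g t) + b t * y (h t)| +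
          (|a t * (w t - w (g t))| + |b t * (y t - y (h t))|) :=
        (abs_add_le _ _).trans (add_le_add_right (abs_add_le _ _) _)
    _ ≤ b t * (E / b₀) + (α * b t * (V * δ) + b t * ((ρ + E) * τ)) :=
        add_le_add (h11.trans h10) (add_le_add h8 h9)
    _ = _ := by ring

/-- The second order equation `y'' + a y' + b y = F` with `a ≥ 2 l`, `b ≤ l²`: the pair
`(y, y' + l y)` satisfies a cooperative system, so that `|F| ≤ b (κ m + e)` with `κ < 1` improves
the bound `m` of `|y|` by a factor. -/
theorem abs_le_of_undelayed_defect (H : CoefficientBounds a b g h s δ τ l b₀ A B α β)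
    (hsT : s ≤ T) (hE : 0 ≤ E)
    (hy : AbsolutelyContinuousOnInterval y T R) (hw : AbsolutelyContinuousOnInterval w T R)
    (hyT : |y T| ≤ E) (hwT : |w T| ≤ E) {m κ c : ℝ} (hm0 : 0 ≤ m) (hκ0 : 0 ≤ κ) (hκ : κ < 1)
    (hc : 0 ≤ c)
    (hm : ∀ t ∈ Icc T R, |y t| ≤ m)
    (hdy : ∀ᵐ t, t ∈ Icc T R → |deriv y t - w t| ≤ E)
    (hF : ∀ᵐ t, t ∈ Icc T R → |deriv w t + a t * w t + b t * y t| ≤ b t * (κ * m + c * E)) :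
    ∀ t ∈ Icc T R, |y t| ≤ (1 - b₀ * (1 - κ) / (A * l)) * m + (c + 3 + 3 / l) * E := by
  have hl := H.l_pos
  have hb₀ := H.b₀_pos
  have hA : 0 < A := by linarith [H.l_le]
  -- Chosen so that `(a - l) η ≤ b (1 - κ)`: the part of `b m` not used up by `F` lowers the bound
  -- of `z` from `l m` to `(l - η) m`.
  set η := b₀ * (1 - κ) / A with hη
  have hηl : η ≤ l := by
    rw [hη, div_le_iff₀ hA]
    nlinarith [H.b₀_le, H.l_le]
  set N := (l - η) * m + (l * c + 2 * l + 2) * E with hN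
  have hηm : 0 ≤ (l - η) * m := mul_nonneg (by linarith) hm0
  have huz := hw.fun_add (hy.const_mul l)
  have hz : ∀ t ∈ Icc T R, |w t + l * y t| ≤ N := by
    refine abs_le_of_ae_abs_deriv_add_mul_le (q := fun t => a t - l) huz ?_ ?_ ?_
    · calc |w T + l * y T| ≤ |w T| + |l * y T| := abs_add_le _ _
        _ = |w T| + l * |y T| := by rw [abs_mul, abs_of_pos hl]
        _ ≤ E + l * E := add_le_add hwT (mul_le_mul_of_nonneg_left hyT hl.le)
        _ ≤ N := by
          have h1 : 0 ≤ (l * c + l + 1) * E := by positivity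
          rw [hN]; linarith
    · filter_upwards [H.le_a] with t h1 ht
      linarith [h1 (hsT.trans ht.1)]
    · filter_upwards [H.le_a, H.a_le, H.le_b, H.b_le_sq, hF, hdy, hy.ae_differentiableAt,
        hw.ae_differentiableAt] with t h1 h2 h3 h4 h5 h6 h7 h8 ht
      have hst := hsT.trans ht.1
      have h1 := h1 hst
      have h2 := h2 hst
      have h3 := h3 hst
      have h4 := h4 hst
      have htu : t ∈ uIcc T R := by rwa [uIcc_of_le (ht.1.trans ht.2)]
      have hb : 0 < b t := hb₀.trans_le h3
      rw [((h8 htu).hasDerivAt.fun_add ((h7 htu).hasDerivAt.const_mul l)).deriv]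
      -- This is where `a² ≥ 4b` is used: `l (a - l) ≥ l² ≥ b`.
      have hp : 0 ≤ l * (a t - l) - b t := by nlinarith
      have e1 : deriv w t + l * deriv y t + (a t - l) * (w t + l * y t) =
          (deriv w t + a t * w t + b t * y t) + (l * (deriv y t - w t) +
            (l * (a t - l) - b t) * y t) := by ring
      have h9 : |l * (deriv y t - w t)| ≤ l * E := by
        rw [abs_mul, abs_of_pos hl]
        exact mul_le_mul_of_nonneg_left (h6 ht) hl.le
      have h10 : |(l * (a t - l) - b t) * y t| ≤ (l * (a t - l) - b t) * m := by
        rw [abs_mul, abs_of_nonneg hp]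
        exact mul_le_mul_of_nonneg_left (hm t ht) hp
      have h11 : (a t - l) * η ≤ b t * (1 - κ) := by
        calc (a t - l) * η ≤ A * η :=
              mul_le_mul_of_nonneg_right (by linarith)
                (div_nonneg (mul_nonneg hb₀.le (by linarith)) hA.le)
          _ = b₀ * (1 - κ) := by rw [hη]; field_simp
          _ ≤ _ := mul_le_mul_of_nonneg_right h3 (by linarith)
      have h12 : b t * (c * E) ≤ (a t - l) * (l * c * E) := by
        have : b t ≤ (a t - l) * l := by nlinarith
        calc b t * (c * E) ≤ (a t - l) * l * (c * E) :=
              mul_le_mul_of_nonneg_right this (by positivity)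
          _ = _ := by ring
      have h13 : l * E ≤ (a t - l) * E := mul_le_mul_of_nonneg_right (by linarith) hE
      have h14 : (a t - l) * η * m ≤ b t * (1 - κ) * m := mul_le_mul_of_nonneg_right h11 hm0
      have h15 : 0 ≤ (a t - l) * ((2 * l + 1) * E) :=
        mul_nonneg (by linarith) (by positivity)
      rw [e1]
      calc _ ≤ |deriv w t + a t * w t + b t * y t| + (|l * (deriv y t - w t)| +
            |(l * (a t - l) - b t) * y t|) :=
            (abs_add_le _ _).trans (add_le_add_right (abs_add_le _ _) _)
        _ ≤ b t * (κ * m + c * E) + (l * E + (l * (a t - l) - b t) * m) :=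
            add_le_add (h5 ht) (add_le_add h9 h10)
        _ ≤ (a t - l) * N := by rw [hN]; linarith
  have hy' : ∀ t ∈ Icc T R, |y t| ≤ (N + (1 + l) * E) / l := by
    refine abs_le_of_ae_abs_deriv_add_mul_le (q := fun _ => l) hy ?_ ?_ ?_
    · rw [le_div_iff₀ hl]
      have h1 : 0 ≤ (l * c + 2 * l + 3) * E := by positivity
      have h2 : |y T| * l ≤ E * l := mul_le_mul_of_nonneg_right hyT hl.le
      rw [hN]; linarith
    · exact Filter.Eventually.of_forall fun t _ => hl.le
    · filter_upwards [hdy] with t h1 ht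
      have h2 := hz t ht
      have h3 : 0 ≤ l * E := by positivity
      calc |deriv y t + l * y t| = |(w t + l * y t) + (deriv y t - w t)| := by ring_nf
        _ ≤ |w t + l * y t| + |deriv y t - w t| := abs_add_le _ _
        _ ≤ N + (1 + l) * E := by linarith [h1 ht]
        _ = _ := by field_simp
  intro t ht
  refine (hy' t ht).trans (le_of_eq ?_)
  rw [hN, hη]
  field_simp
  ring

/-- Bounded perturbations of the equation and of the history have bounded solutions, uniformly in
the initial time. -/
theorem exists_uniform_bound (H : CoefficientBounds a b g h s δ τ l b₀ A B α β) :
    ∃ C : ℝ, 1 ≤ C ∧ ∀ (T R E : ℝ) (y w : ℝ → ℝ), s + 2 * (δ + τ) ≤ T →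
      IsApproxSolution a b g h (δ + τ) T R E y w →
      ∀ t ∈ Icc (T - 2 * (δ + τ)) R, |y t| ≤ C * E ∧ |w t| ≤ C * E := by
  have hδ := H.δ_nonneg
  have hτ := H.τ_nonneg
  have hl := H.l_pos
  have hb₀ := H.b₀_pos
  have hB := H.B_nonneg
  have hα := H.α_nonneg
  have hβ := H.β_nonneg
  have hA : 0 < A := by linarith [H.l_le]
  have hκ := H.contraction
  set κ := δ * α * (A * β + B) + τ * β with hκd
  have hκ0 : 0 ≤ κ := by positivity
  set c₁ := 1 + (1 + A + B) / (2 * l) with hc₁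
  have hc₁0 : 1 ≤ c₁ := by
    have : 0 ≤ (1 + A + B) / (2 * l) := by positivity
    linarith
  set c₂ := δ * α * (A * c₁ + 1) + τ * (c₁ + 1) + 1 / b₀ with hc₂
  have hc₂0 : 0 ≤ c₂ := by positivity
  set θ := b₀ * (1 - κ) / (A * l) with hθ
  have hθ0 : 0 < θ := div_pos (mul_pos hb₀ (by linarith)) (by positivity)
  set c₃ := (c₂ + 3 + 3 / l) / θ with hc₃
  have hc₃0 : 0 ≤ c₃ := by positivity
  refine ⟨β * c₃ + c₁ + c₃, by nlinarith [mul_nonneg hβ hc₃0], ?_⟩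
  intro T R E y w hT S
  have hE := S.E_nonneg
  have hTR := S.le
  have hne : (Icc (T - 2 * (δ + τ)) R).Nonempty := ⟨T, by linarith, hTR⟩
  have hcy : ContinuousOn (fun t => |y t|) (Icc (T - 2 * (δ + τ)) R) := by
    have := S.ac_y.continuousOn
    rw [uIcc_of_le (by linarith)] at this
    exact this.abs
  obtain ⟨t', ht', hmax⟩ := isCompact_Icc.exists_isMaxOn hne hcy
  set m := |y t'| with hmd
  have hm : ∀ t ∈ Icc (T - 2 * (δ + τ)) R, |y t| ≤ m := fun t ht => hmax ht
  have hm0 : 0 ≤ m := abs_nonneg _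
  have hw := abs_velocity_le H hT S hm
  have hF := ae_abs_undelayed_defect_le H hT S hm hw
  -- Either the maximum lies in the history, or `m ≤ (1 - θ) m + (c₂ + 3 + 3/l) E` at the maximum
  -- point, and `θ m` is isolated.
  have hmE : m ≤ c₃ * E := by
    rw [hc₃, div_mul_eq_mul_div, le_div_iff₀ hθ0]
    rcases le_total t' T with h1 | h1
    · have h2 := S.past_y t' ⟨ht'.1, h1⟩
      have h3 : θ ≤ 1 := by
        rw [hθ, div_le_one (by positivity)]
        nlinarith [H.b₀_le, H.l_le]
      have h4 : 0 ≤ (c₂ + 2 + 3 / l) * E := by positivity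
      have h5 : m * θ ≤ m := mul_le_of_le_one_right hm0 h3
      linarith
    · have := abs_le_of_undelayed_defect H (by linarith) hE
        (S.ac_y.mono_Icc (by linarith) hTR le_rfl) (S.ac_w.mono_Icc (by linarith) hTR le_rfl)
        (S.past_y T ⟨by linarith, le_rfl⟩) (S.past_w T ⟨by linarith, le_rfl⟩) hm0 hκ0 hκ hc₂0
        (fun t ht => hm t ⟨by linarith [ht.1], ht.2⟩)
        (by
          filter_upwards [S.deriv_y] with t h2 ht
          exact h2 ⟨by linarith [ht.1], ht.2⟩)
        (by
          filter_upwards [hF] with t h2 ht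
          refine (h2 ht).trans (le_of_eq ?_)
          rw [hκd, hc₂]; ring)
        t' ⟨h1, ht'.2⟩
      linarith
  intro t ht
  have h1 : 0 ≤ β * c₃ * E := by positivity
  have h2 : 0 ≤ c₁ * E := by positivity
  have h3 : 0 ≤ c₃ * E := by positivity
  constructor
  · linarith [hm t ht]
  · have := mul_le_mul_of_nonneg_left hmE hβ
    linarith [hw t ht]

end

/-! ### Regularity, crude growth and exponential weighting of solutions. -/

section

variable {a b g h : ℝ → ℝ} {t₀ x₀ x₀' : ℝ} {φ ψ : Iio t₀ → ℝ} {x v : ℝ → ℝ}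

theorem IsSolution.continuousOn_vel (S : IsSolution a b g h t₀ φ ψ x₀ x₀' x v) {T : ℝ}
    (hT : t₀ ≤ T) : ContinuousOn v (Icc t₀ T) := by
  have := (S.absCont T hT).continuousOn
  rwa [uIcc_of_le hT] at this

theorem IsSolution.absCont_pos (S : IsSolution a b g h t₀ φ ψ x₀ x₀' x v) {T : ℝ}
    (hT : t₀ ≤ T) : AbsolutelyContinuousOnInterval x t₀ T := by
  obtain ⟨C, hC⟩ := (S.absCont T hT).exists_bound
  rw [uIcc_of_le hT] at hC
  have : LipschitzOnWith C.toNNReal x (Icc t₀ T) :=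
    (convex_Icc t₀ T).lipschitzOnWith_of_nnnorm_hasDerivWithin_le
      (fun t ht => (S.hasDeriv t ht.1).mono Icc_subset_Ici_self)
      (fun t ht => by
        rw [← NNReal.coe_le_coe, coe_nnnorm]
        exact (hC t ht).trans (Real.le_coe_toNNReal C))
  refine LipschitzOnWith.absolutelyContinuousOnInterval (K := C.toNNReal) ?_
  rwa [uIcc_of_le hT]

theorem IsSolution.hasDerivAt_pos (S : IsSolution a b g h t₀ φ ψ x₀ x₀' x v) {t : ℝ}
    (ht : t₀ < t) : HasDerivAt x (v t) t :=
  (S.hasDeriv t ht.le).hasDerivAt (Ici_mem_nhds ht)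

/-- At `t₀` itself a two-sided derivative may fail, as the past positions are arbitrary. -/
theorem IsSolution.ae_hasDerivAt_pos (S : IsSolution a b g h t₀ φ ψ x₀ x₀' x v) :
    ∀ᵐ t, t₀ ≤ t → HasDerivAt x (v t) t := by
  have : ∀ᵐ t : ℝ, t ≠ t₀ := by simp [ae_iff, measure_singleton]
  filter_upwards [this] with t h1 h2
  exact S.hasDerivAt_pos (lt_of_le_of_ne h2 h1.symm)

theorem IsSolution.ae_equation (S : IsSolution a b g h t₀ φ ψ x₀ x₀' x v) :
    ∀ᵐ t, t₀ ≤ t → deriv v t + a t * v (g t) + b t * x (h t) = 0 :=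
  (ae_restrict_iff' measurableSet_Ici).1 S.equation

/-- Solutions grow at most exponentially. -/
theorem IsSolution.abs_le_exp (S : IsSolution a b g h t₀ φ ψ x₀ x₀' x v) (ht₀ : 0 ≤ t₀)
    {A B I : ℝ} (hA : 0 ≤ A) (hB : 0 ≤ B) (hI : 0 ≤ I)
    (ha : ∀ᵐ t, 0 ≤ t → |a t| ≤ A) (hb : ∀ᵐ t, 0 ≤ t → |b t| ≤ B)
    (hg : ∀ t, 0 ≤ t → g t ≤ t) (hh : ∀ t, 0 ≤ t → h t ≤ t)
    (hφ : ∀ s, |φ s| ≤ I) (hψ : ∀ s, |ψ s| ≤ I) (hx₀ : |x₀| ≤ I) (hx₀' : |x₀'| ≤ I)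
    {R : ℝ} (hR : t₀ ≤ R) :
    |x R| ≤ 2 * I * Real.exp (2 * (A + B + 1) * (R - t₀)) ∧
    |v R| ≤ 2 * I * Real.exp (2 * (A + B + 1) * (R - t₀)) := by
  set L := 2 * (A + B + 1) with hL
  have hL0 : 0 < L := by positivity
  have hxac := S.absCont_pos hR
  have hvac := S.absCont R hR
  have hxc : ContinuousOn x (Icc t₀ R) := by
    have := hxac.continuousOn
    rwa [uIcc_of_le hR] at this
  have hvc := S.continuousOn_vel hR
  have hfc : ContinuousOn (fun t => max |x t| |v t| * Real.exp (-(L * (t - t₀)))) (Icc t₀ R) :=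
    (hxc.abs.sup hvc.abs).mul (by fun_prop)
  obtain ⟨t', ht', hmax⟩ := isCompact_Icc.exists_isMaxOn (nonempty_Icc.2 hR) hfc
  set J := max |x t'| |v t'| * Real.exp (-(L * (t' - t₀))) with hJ
  have hJb : ∀ t ∈ Icc t₀ R, max |x t| |v t| ≤ J * Real.exp (L * (t - t₀)) := by
    intro t ht
    have h1 : max |x t| |v t| * Real.exp (-(L * (t - t₀))) ≤ J := hmax ht
    rwa [Real.exp_neg, ← div_eq_mul_inv, div_le_iff₀ (Real.exp_pos _)] at h1
  set K := max J I with hK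
  have hK0 : 0 ≤ K := hI.trans (le_max_right _ _)
  have hpast : ∀ r ∈ Icc t₀ R, ∀ s ≤ r, |x s| ≤ K * Real.exp (L * (r - t₀)) ∧
      |v s| ≤ K * Real.exp (L * (r - t₀)) := by
    intro r hr s hsr
    have h1 : 1 ≤ Real.exp (L * (r - t₀)) :=
      Real.one_le_exp (mul_nonneg hL0.le (by linarith [hr.1]))
    rcases lt_or_ge s t₀ with hs | hs
    · have h2 : I ≤ K * Real.exp (L * (r - t₀)) :=
        (le_max_right J I).trans (le_mul_of_one_le_right hK0 h1)
      rw [S.past_pos ⟨s, hs⟩, S.past_vel ⟨s, hs⟩]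
      exact ⟨(hφ _).trans h2, (hψ _).trans h2⟩
    · have h2 := hJb s ⟨hs, hsr.trans hr.2⟩
      have h3 : J * Real.exp (L * (s - t₀)) ≤ K * Real.exp (L * (r - t₀)) :=
        mul_le_mul (le_max_left _ _) (Real.exp_le_exp.2 (by gcongr)) (Real.exp_pos _).le hK0
      exact ⟨(le_max_left _ _).trans (h2.trans h3), (le_max_right _ _).trans (h2.trans h3)⟩
  have hkd : ∀ r, HasDerivAt (fun r => K / 2 * Real.exp (L * (r - t₀)))
      ((A + B + 1) * (K * Real.exp (L * (r - t₀)))) r := by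
    intro r
    have h1 : HasDerivAt (fun r => L * (r - t₀)) L r := by
      simpa using ((hasDerivAt_id r).sub_const t₀).const_mul L
    convert! (h1.exp.const_mul (K / 2)) using 1
    rw [hL]; ring
  have hkac : ∀ t, AbsolutelyContinuousOnInterval
      (fun r => K / 2 * Real.exp (L * (r - t₀))) t₀ t := fun t =>
    ContDiffOn.absolutelyContinuousOnInterval (ContDiff.contDiffOn (by fun_prop))
  have hgrow : ∀ t ∈ Icc t₀ R, |x t| ≤ (I + K / 2) * Real.exp (L * (t - t₀)) ∧
      |v t| ≤ (I + K / 2) * Real.exp (L * (t - t₀)) := by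
    intro t ht
    have h1 : 1 ≤ Real.exp (L * (t - t₀)) :=
      Real.one_le_exp (mul_nonneg hL0.le (by linarith [ht.1]))
    have hx := abs_sub_le_of_ae_abs_deriv_le ht.1 (hxac.mono_Icc le_rfl ht.1 ht.2) (hkac t) (by
      filter_upwards [S.ae_hasDerivAt_pos] with r h2 hr
      rw [(h2 hr.1).deriv, (hkd r).deriv]
      have h3 := (hpast r ⟨hr.1, hr.2.trans ht.2⟩ r le_rfl).2
      have h4 : 0 ≤ (A + B) * (K * Real.exp (L * (r - t₀))) := by positivity
      linarith)
    have hv := abs_sub_le_of_ae_abs_deriv_le ht.1 (hvac.mono_Icc le_rfl ht.1 ht.2) (hkac t) (by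
      filter_upwards [S.ae_equation, ha, hb] with r h2 h3 h4 hr
      have hr0 : 0 ≤ r := ht₀.trans hr.1
      rw [(hkd r).deriv]
      have h5 := (hpast r ⟨hr.1, hr.2.trans ht.2⟩ _ (hg r hr0)).2
      have h6 := (hpast r ⟨hr.1, hr.2.trans ht.2⟩ _ (hh r hr0)).1
      have h7 : |a r * v (g r)| ≤ A * (K * Real.exp (L * (r - t₀))) := by
        rw [abs_mul]
        exact mul_le_mul (h3 hr0) h5 (abs_nonneg _) hA
      have h8 : |b r * x (h r)| ≤ B * (K * Real.exp (L * (r - t₀))) := by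
        rw [abs_mul]
        exact mul_le_mul (h4 hr0) h6 (abs_nonneg _) hB
      have h9 : 0 ≤ K * Real.exp (L * (r - t₀)) := by positivity
      have h10 : deriv v r = -(a r * v (g r) + b r * x (h r)) := by linarith [h2 hr.1]
      rw [h10, abs_neg]
      linarith [abs_add_le (a r * v (g r)) (b r * x (h r))])
    simp only [sub_self, mul_zero, Real.exp_zero] at hx hv
    rw [S.init_pos] at hx
    rw [S.init_vel] at hv
    have hI' : I ≤ I * Real.exp (L * (t - t₀)) := le_mul_of_one_le_right hI h1
    constructor
    · have := abs_sub_abs_le_abs_sub (x t) x₀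
      linarith
    · have := abs_sub_abs_le_abs_sub (v t) x₀'
      linarith
  have hJK : J ≤ I + K / 2 := by
    obtain ⟨h1, h2⟩ := hgrow t' ht'
    rw [hJ, Real.exp_neg, ← div_eq_mul_inv, div_le_iff₀ (Real.exp_pos _)]
    exact max_le h1 h2
  -- The factor 2 in `L` makes the integrated growth only `K / 2`, so `J ≤ I + K / 2` closes.
  have hKI : K ≤ 2 * I := by
    rw [hK]
    refine max_le ?_ (by linarith)
    rcases le_total J I with h1 | h1
    · linarith
    · rw [hK, max_eq_left h1] at hJK
      linarith
  obtain ⟨h1, h2⟩ := hgrow R ⟨hR, le_rfl⟩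
  have h3 : (I + K / 2) * Real.exp (L * (R - t₀)) ≤ 2 * I * Real.exp (L * (R - t₀)) :=
    mul_le_mul_of_nonneg_right (by linarith) (Real.exp_pos _).le
  exact ⟨h1.trans h3, h2.trans h3⟩

/-- After multiplication by `e^{μ (t - T)}`, a solution solves the equation up to a small multiple
of its norm. -/
theorem IsSolution.isApproxSolution_exp_mul {s δ τ l b₀ A B α β T R D J μ : ℝ}
    (S : IsSolution a b g h t₀ φ ψ x₀ x₀' x v)
    (H : CoefficientBounds a b g h s δ τ l b₀ A B α β)
    (hsT : s + 2 * (δ + τ) ≤ T) (ht₀T : t₀ + 2 * (δ + τ) ≤ T) (hTR : T ≤ R)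
    (hμ : 0 ≤ μ) (hD : 0 ≤ D)
    (hxD : ∀ t ∈ Icc t₀ T, |x t| ≤ D) (hvD : ∀ t ∈ Icc t₀ T, |v t| ≤ D)
    (hxJ : ∀ t ∈ Icc (T - 2 * (δ + τ)) R, |Real.exp (μ * (t - T)) * x t| ≤ J)
    (hvJ : ∀ t ∈ Icc (T - 2 * (δ + τ)) R, |Real.exp (μ * (t - T)) * v t| ≤ J) :
    IsApproxSolution a b g h (δ + τ) T R
      (D + (μ + (A + B) * (Real.exp (μ * (δ + τ)) - 1)) * J)
      (fun t => Real.exp (μ * (t - T)) * x t) (fun t => Real.exp (μ * (t - T)) * v t) := by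
  have hδ := H.δ_nonneg
  have hτ := H.τ_nonneg
  have hl := H.l_pos
  have hB := H.B_nonneg
  have hA : 0 < A := by linarith [H.l_le]
  have hJ0 : 0 ≤ J := (abs_nonneg _).trans (hxJ T ⟨by linarith, hTR⟩)
  set σ := δ + τ with hσ
  set ε := Real.exp (μ * σ) - 1 with hε
  have hσ0 : 0 ≤ σ := add_nonneg hδ hτ
  have hε0 : 0 ≤ ε := by
    have := Real.one_le_exp (mul_nonneg hμ hσ0)
    linarith
  have hEJ : 0 ≤ (μ + (A + B) * ε) * J := by positivity
  have hed : ∀ t, HasDerivAt (fun r => Real.exp (μ * (r - T))) (Real.exp (μ * (t - T)) * μ) t := by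
    intro t
    have h1 : HasDerivAt (fun r => μ * (r - T)) μ t := by
      simpa using ((hasDerivAt_id t).sub_const T).const_mul μ
    exact h1.exp
  have heac : ∀ p q, AbsolutelyContinuousOnInterval (fun r => Real.exp (μ * (r - T))) p q :=
    fun p q => ContDiffOn.absolutelyContinuousOnInterval (ContDiff.contDiffOn (by fun_prop))
  have hexp : ∀ t ≤ T, ∀ c : ℝ, |c| ≤ D → |Real.exp (μ * (t - T)) * c| ≤ D := by
    intro t ht c hc
    rw [abs_mul, abs_of_pos (Real.exp_pos _)]
    have : Real.exp (μ * (t - T)) ≤ 1 :=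
      Real.exp_le_one_iff.2 (mul_nonpos_of_nonneg_of_nonpos hμ (by linarith))
    calc _ ≤ 1 * D := mul_le_mul this hc (abs_nonneg _) zero_le_one
      _ = D := one_mul D
  have hdiff : ∀ p q, p ≤ q → q ≤ p + σ → |1 - Real.exp (μ * (q - p))| ≤ ε := by
    intro p q hpq hqp
    have h1 : 1 ≤ Real.exp (μ * (q - p)) := Real.one_le_exp (mul_nonneg hμ (by linarith))
    have h2 : Real.exp (μ * (q - p)) ≤ Real.exp (μ * σ) :=
      Real.exp_le_exp.2 (mul_le_mul_of_nonneg_left (by linarith) hμ)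
    rw [abs_sub_comm, abs_of_nonneg (by linarith)]
    linarith
  refine ⟨hTR, by linarith,
    (heac _ _).fun_mul ((S.absCont_pos (T := R) (by linarith)).mono_Icc (by linarith)
      (by linarith) le_rfl),
    (heac _ _).fun_mul ((S.absCont R (by linarith)).mono_Icc (by linarith)
      (by linarith) le_rfl), ?_, ?_, ?_, ?_⟩
  · intro t ht
    have := hexp t ht.2 _ (hxD t ⟨by linarith [ht.1], ht.2⟩)
    linarith
  · intro t ht
    have := hexp t ht.2 _ (hvD t ⟨by linarith [ht.1], ht.2⟩)
    linarith
  · filter_upwards [S.ae_hasDerivAt_pos] with t h1 ht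
    rw [((hed t).fun_mul (h1 (by linarith [ht.1]))).deriv]
    have e1 : Real.exp (μ * (t - T)) * μ * x t + Real.exp (μ * (t - T)) * v t -
        Real.exp (μ * (t - T)) * v t = μ * (Real.exp (μ * (t - T)) * x t) := by ring
    rw [e1, abs_mul, abs_of_nonneg hμ]
    have h2 := mul_le_mul_of_nonneg_left (hxJ t ht) hμ
    have h3 : 0 ≤ (A + B) * ε * J := by positivity
    linarith
  · filter_upwards [S.ae_equation, (S.absCont R (by linarith)).ae_differentiableAt, H.le_a,
      H.a_le, H.le_b, H.b_le] with t h1 h2 h3 h4 h5 h6 ht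
    have hst : s ≤ t := by linarith [ht.1]
    have ha : 0 < a t := by linarith [h3 hst]
    have hb : 0 < b t := H.b₀_pos.trans_le (h5 hst)
    have hg := H.g_mem t hst
    have hh := H.h_mem t hst
    have h1 := h1 (by linarith [ht.1])
    have h2 := h2 (by rw [uIcc_of_le (by linarith)]; exact ⟨by linarith [ht.1], ht.2⟩)
    rw [((hed t).fun_mul h2.hasDerivAt).deriv]
    have h7 := hvJ (g t) ⟨by linarith [ht.1], hg.2.trans ht.2⟩
    have h8 := hxJ (h t) ⟨by linarith [ht.1], hh.2.trans ht.2⟩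
    have h9 := hvJ t ⟨by linarith [ht.1], ht.2⟩
    have h10 := hdiff (g t) t hg.2 (by linarith)
    have h11 := hdiff (h t) t hh.2 (by linarith)
    have eg : Real.exp (μ * (t - T)) =
        Real.exp (μ * (g t - T)) * Real.exp (μ * (t - g t)) := by
      rw [← Real.exp_add]; ring_nf
    have eh : Real.exp (μ * (t - T)) =
        Real.exp (μ * (h t - T)) * Real.exp (μ * (t - h t)) := by
      rw [← Real.exp_add]; ring_nf
    -- Weighting produces a term `μ w` and, from each delay, a mismatch factor `1 - e^{μ (t - g)}`
    -- or `1 - e^{μ (t - h)}`; each vanishes as `μ → 0`.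
    have e1 : Real.exp (μ * (t - T)) * μ * v t + Real.exp (μ * (t - T)) * deriv v t +
        a t * (Real.exp (μ * (g t - T)) * v (g t)) + b t * (Real.exp (μ * (h t - T)) * x (h t)) =
        μ * (Real.exp (μ * (t - T)) * v t) +
        (a t * ((Real.exp (μ * (g t - T)) * v (g t)) * (1 - Real.exp (μ * (t - g t)))) +
        b t * ((Real.exp (μ * (h t - T)) * x (h t)) * (1 - Real.exp (μ * (t - h t))))) := by
      have h12 : deriv v t = -(a t * v (g t)) - b t * x (h t) := by linarith
      rw [h12]
      linear_combination (-(a t * v (g t))) * eg + (-(b t * x (h t))) * eh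
    have h13 : |a t * ((Real.exp (μ * (g t - T)) * v (g t)) * (1 - Real.exp (μ * (t - g t))))| ≤
        A * (J * ε) := by
      rw [abs_mul, abs_of_pos ha, abs_mul]
      exact mul_le_mul (h4 hst) (mul_le_mul h7 h10 (abs_nonneg _) hJ0) (by positivity) hA.le
    have h14 : |b t * ((Real.exp (μ * (h t - T)) * x (h t)) * (1 - Real.exp (μ * (t - h t))))| ≤
        B * (J * ε) := by
      rw [abs_mul, abs_of_pos hb, abs_mul]
      exact mul_le_mul (h6 hst) (mul_le_mul h8 h11 (abs_nonneg _) hJ0) (by positivity) hB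
    have h15 : |μ * (Real.exp (μ * (t - T)) * v t)| ≤ μ * J := by
      rw [abs_mul, abs_of_nonneg hμ]
      exact mul_le_mul_of_nonneg_left h9 hμ
    rw [e1]
    calc _ ≤ _ := (abs_add_le _ _).trans (add_le_add_right (abs_add_le _ _) _)
      _ ≤ μ * J + (A * (J * ε) + B * (J * ε)) := add_le_add h15 (add_le_add h13 h14)
      _ ≤ _ := by linarith

end

/-! ### Exponential decay. -/

theorem exists_pos_mul_weight_le (C A B σ : ℝ) :
    ∃ μ : ℝ, 0 < μ ∧ C * (μ + (A + B) * (Real.exp (μ * σ) - 1)) ≤ 1 / 2 := by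
  have hc : Continuous fun μ : ℝ => C * (μ + (A + B) * (Real.exp (μ * σ) - 1)) := by fun_prop
  have h0 : Filter.Tendsto (fun μ : ℝ => C * (μ + (A + B) * (Real.exp (μ * σ) - 1)))
      (nhdsWithin 0 (Ioi 0)) (nhds 0) := by
    have := (hc.tendsto 0).mono_left (nhdsWithin_le_nhds (s := Ioi 0))
    simpa using this
  have h1 := h0.eventually (ge_mem_nhds (by norm_num : (0 : ℝ) < 1 / 2))
  obtain ⟨μ, h2, h3⟩ := (h1.and self_mem_nhdsWithin).exists
  exact ⟨μ, h3, h2⟩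

theorem exponentiallyStable_of_coefficientBounds {a b g h : ℝ → ℝ}
    {s δ τ l b₀ A B α β A' B' : ℝ} (H : CoefficientBounds a b g h s δ τ l b₀ A B α β)
    (hs : 0 ≤ s) (hA' : 0 ≤ A') (hB' : 0 ≤ B')
    (ha : ∀ᵐ t, 0 ≤ t → |a t| ≤ A') (hb : ∀ᵐ t, 0 ≤ t → |b t| ≤ B')
    (hg : ∀ t, 0 ≤ t → g t ≤ t) (hh : ∀ t, 0 ≤ t → h t ≤ t) :
    ExponentiallyStable a b g h := by
  have hσ0 : 0 ≤ δ + τ := add_nonneg H.δ_nonneg H.τ_nonneg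
  obtain ⟨C, hC1, hC⟩ := exists_uniform_bound H
  obtain ⟨μ, hμ, hμC⟩ := exists_pos_mul_weight_le C A B (δ + τ)
  set σ := δ + τ with hσ
  set L := 2 * (A' + B' + 1) with hL
  have hL0 : 0 < L := by positivity
  set P := s + 2 * σ with hP
  have hP0 : 0 ≤ P := by positivity
  refine ⟨2 * C * (2 * Real.exp (L * P)) * Real.exp (μ * P), μ, by positivity, hμ, ?_⟩
  intro t₀ ht₀ φ ψ _ _ ⟨Cφ, hCφ⟩ ⟨Cψ, hCψ⟩ x₀ x₀' x v S t ht
  set Q := ⨆ r : Iio t₀, (|φ r| + |ψ r|) with hQ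
  have hbdd : BddAbove (range fun r : Iio t₀ => |φ r| + |ψ r|) :=
    ⟨Cφ + Cψ, by rintro _ ⟨r, rfl⟩; exact add_le_add (hCφ r) (hCψ r)⟩
  have hQr : ∀ r, |φ r| + |ψ r| ≤ Q := fun r => le_ciSup hbdd r
  have hQ0 : 0 ≤ Q := Real.iSup_nonneg fun r => by positivity
  set I := |x₀| + |x₀'| + Q with hI
  have hI0 : 0 ≤ I := by positivity
  have hcrude := fun R (hR : t₀ ≤ R) => S.abs_le_exp ht₀ hA' hB' hI0 ha hb hg hh
    (fun r => by linarith [hQr r, abs_nonneg (ψ r), abs_nonneg x₀, abs_nonneg x₀'])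
    (fun r => by linarith [hQr r, abs_nonneg (φ r), abs_nonneg x₀, abs_nonneg x₀'])
    (by linarith [abs_nonneg x₀']) (by linarith [abs_nonneg x₀]) hR
  set D := 2 * I * Real.exp (L * P) with hD
  have hD0 : 0 ≤ D := by positivity
  -- The window `[T - 2σ, T]` lies after both `t₀` and `s`, so the prescribed past is out of reach
  -- of the delays there. As `t₀, s ≥ 0`, the waiting time `T - t₀` is at most `P`, uniformly in
  -- `t₀`.
  set T := max t₀ s + 2 * σ with hT
  have ht₀T : t₀ + 2 * σ ≤ T := by linarith [le_max_left t₀ s]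
  have hsT : s + 2 * σ ≤ T := by linarith [le_max_right t₀ s]
  have hTP : T - t₀ ≤ P := by
    have : max t₀ s ≤ t₀ + s := max_le (by linarith) (by linarith)
    linarith
  have hDT : ∀ r ∈ Icc t₀ T, |x r| ≤ D ∧ |v r| ≤ D := by
    intro r hr
    have h1 : 2 * I * Real.exp (L * (r - t₀)) ≤ D :=
      mul_le_mul_of_nonneg_left
        (Real.exp_le_exp.2 (mul_le_mul_of_nonneg_left (by linarith [hr.2]) hL0.le)) (by positivity)
    exact ⟨(hcrude r hr.1).1.trans h1, (hcrude r hr.1).2.trans h1⟩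
  have hmain : |x t| ≤ 2 * C * D * Real.exp (-(μ * (t - T))) := by
    have hCD : D ≤ 2 * C * D := by nlinarith
    rcases le_total t T with htT | htT
    · have h1 : 1 ≤ Real.exp (-(μ * (t - T))) :=
        Real.one_le_exp (by nlinarith)
      exact ((hDT t ⟨ht, htT⟩).1.trans hCD).trans
        (le_mul_of_one_le_right (by positivity) h1)
    · have hsub : Icc (T - 2 * σ) t ⊆ Icc t₀ t := Icc_subset_Icc (by linarith) le_rfl
      have hxc : ContinuousOn x (Icc t₀ t) := by
        have := (S.absCont_pos ht).continuousOn
        rwa [uIcc_of_le ht] at this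
      have hvc := S.continuousOn_vel ht
      have hexpc : ContinuousOn (fun r => Real.exp (μ * (r - T))) (Icc (T - 2 * σ) t) := by
        fun_prop
      have hfc : ContinuousOn (fun r => max |Real.exp (μ * (r - T)) * x r|
          |Real.exp (μ * (r - T)) * v r|) (Icc (T - 2 * σ) t) :=
        (hexpc.mul (hxc.mono hsub)).abs.sup (hexpc.mul (hvc.mono hsub)).abs
      obtain ⟨t', ht', hmax⟩ := isCompact_Icc.exists_isMaxOn
        (nonempty_Icc.2 (by linarith : T - 2 * σ ≤ t)) hfc
      set J := max |Real.exp (μ * (t' - T)) * x t'| |Real.exp (μ * (t' - T)) * v t'| with hJ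
      have hJmax : ∀ r ∈ Icc (T - 2 * σ) t, max |Real.exp (μ * (r - T)) * x r|
          |Real.exp (μ * (r - T)) * v r| ≤ J := fun r hr => hmax hr
      have happ := S.isApproxSolution_exp_mul H hsT ht₀T htT hμ.le hD0
        (fun r hr => (hDT r hr).1) (fun r hr => (hDT r hr).2)
        (fun r hr => (le_max_left _ _).trans (hJmax r hr))
        (fun r hr => (le_max_right _ _).trans (hJmax r hr))
      have hbound := hC T t _ _ _ hsT happ
      have hJ0 : 0 ≤ J := (abs_nonneg _).trans (le_max_left _ _)
      -- By the choice of `μ`, `J ≤ C D + J / 2`.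
      have hJD : J ≤ 2 * C * D := by
        have h1 : J ≤ C * (D + (μ + (A + B) * (Real.exp (μ * σ) - 1)) * J) :=
          max_le (hbound t' ht').1 (hbound t' ht').2
        have h2 := mul_le_mul_of_nonneg_right hμC hJ0
        linarith
      have h3 : |Real.exp (μ * (t - T)) * x t| ≤ 2 * C * D :=
        ((le_max_left _ _).trans (hJmax t ⟨by linarith, le_rfl⟩)).trans hJD
      rw [abs_mul, abs_of_pos (Real.exp_pos _)] at h3
      rw [Real.exp_neg, ← div_eq_mul_inv, le_div_iff₀ (Real.exp_pos _)]
      linarith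
  have hexp : Real.exp (-(μ * (t - T))) ≤ Real.exp (-μ * (t - t₀)) * Real.exp (μ * P) := by
    rw [← Real.exp_add, Real.exp_le_exp]
    nlinarith
  calc |x t| ≤ 2 * C * D * Real.exp (-(μ * (t - T))) := hmain
    _ ≤ 2 * C * D * (Real.exp (-μ * (t - t₀)) * Real.exp (μ * P)) :=
        mul_le_mul_of_nonneg_left hexp (by positivity)
    _ = _ := by rw [hD]; ring

/-! ### Essential bounds and verification of the hypotheses. -/

/-- The bound `c` only ensures finiteness: `toReal` would send an infinite norm to `0`. -/
theorem ae_abs_le_normLinfty {f : ℝ → ℝ} {T c : ℝ}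
    (hf : ∀ᵐ t, T ≤ t → |f t| ≤ c) : ∀ᵐ t, T ≤ t → |f t| ≤ normLinfty T f := by
  have hf' : ∀ᵐ t ∂(volume.restrict (Ici T)), ‖f t‖ ≤ c :=
    (ae_restrict_iff' measurableSet_Ici).2 hf
  have hfin : eLpNormEssSup f (volume.restrict (Ici T)) ≠ ⊤ :=
    (eLpNormEssSup_lt_top_of_ae_bound hf').ne
  refine (ae_restrict_iff' measurableSet_Ici).1 ?_
  filter_upwards [ae_le_eLpNormEssSup (f := f) (μ := volume.restrict (Ici T))] with t ht
  have := ENNReal.toReal_mono hfin ht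
  rwa [toReal_enorm, Real.norm_eq_abs, ← eLpNorm_exponent_top] at this

theorem ae_essInfFrom_le {f : ℝ → ℝ} {T c : ℝ} (hf : ∀ᵐ t, T ≤ t → |f t| ≤ c) :
    ∀ᵐ t, T ≤ t → essInfFrom T f ≤ f t := by
  refine (ae_restrict_iff' measurableSet_Ici).1 (ae_essInf_le ⟨-c, ?_⟩)
  rw [Filter.eventually_map]
  exact ((ae_restrict_iff' measurableSet_Ici).2 hf).mono fun t ht => (abs_le.1 ht).1

theorem ae_le_essSupFrom {f : ℝ → ℝ} {T c : ℝ} (hf : ∀ᵐ t, T ≤ t → |f t| ≤ c) :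
    ∀ᵐ t, T ≤ t → f t ≤ essSupFrom T f := by
  refine (ae_restrict_iff' measurableSet_Ici).1 (ae_le_essSup ⟨c, ?_⟩)
  rw [Filter.eventually_map]
  exact ((ae_restrict_iff' measurableSet_Ici).2 hf).mono fun t ht => (abs_le.1 ht).2

/-- Turns almost everywhere inequalities into inequalities between constants, since a half-line is
not null. -/
theorem exists_ge_of_ae {p : ℝ → Prop} {T : ℝ} (hp : ∀ᵐ t, T ≤ t → p t) : ∃ t, T ≤ t ∧ p t := by
  have : (ae (volume.restrict (Ici T))).NeBot := by
    rw [ae_neBot, Ne, Measure.restrict_eq_zero]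
    simp
  obtain ⟨t, h1, h2⟩ := (((ae_restrict_iff' measurableSet_Ici).2 hp).and
    (ae_restrict_mem measurableSet_Ici)).exists
  exact ⟨t, h2, h1⟩

theorem intervalIntegrable_of_memLp_top {f : ℝ → ℝ} {p q r : ℝ}
    (hf : MemLp f ⊤ (volume.restrict (Ici r))) (hp : r ≤ p) (hpq : p ≤ q) :
    IntervalIntegrable f volume p q := by
  rw [intervalIntegrable_iff_integrableOn_Ioc_of_le hpq]
  have hsub : Ioc p q ⊆ Ici r := fun t ht => hp.trans ht.1.le
  have h1 : MemLp f ⊤ (volume.restrict (Ioc p q)) :=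
    hf.mono_measure (Measure.restrict_mono hsub le_rfl)
  exact h1.integrable le_top

end SecondOrderDelay

open SecondOrderDelay in
theorem theorem5 (a b g h : ℝ → ℝ)
    (ha : MemLp a ⊤ (volume.restrict (Set.Ici 0)))
    (hb : MemLp b ⊤ (volume.restrict (Set.Ici 0)))
    (hg : AEMeasurable g (volume.restrict (Set.Ici 0)))
    (hh : AEMeasurable h (volume.restrict (Set.Ici 0)))
    (hgt : ∀ t, 0 ≤ t → g t ≤ t)
    (hht : ∀ t, 0 ≤ t → h t ≤ t)
    (t₀ : ℝ) (ht₀ : 0 ≤ t₀)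
    (ha_pos : 0 < SecondOrderDelay.essInfFrom t₀ a)
    (hb_pos : 0 < SecondOrderDelay.essInfFrom t₀ b)
    (hab : 4 * SecondOrderDelay.essSupFrom t₀ b ≤ SecondOrderDelay.essInfFrom t₀ a ^ 2)
    (hint : ∀ t, t₀ ≤ t → (∫ s in (max (g t) 0)..t, a s) ≤ 1 / Real.exp 1)
    (δ τ : ℝ)
    (hδ : ∀ t, t₀ ≤ t → t - g t ≤ δ)
    (hτ : ∀ t, t₀ ≤ t → t - h t ≤ τ)
    (t₁ : ℝ) (ht₁ : t₀ + δ ≤ t₁)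
    (hmain : δ * SecondOrderDelay.normLinfty t₁ (fun t => a t / b t) *
          (SecondOrderDelay.normLinfty t₁ a * SecondOrderDelay.normLinfty t₁ (fun t => b t / a t)
            + SecondOrderDelay.normLinfty t₁ b)
        + τ * SecondOrderDelay.normLinfty t₁ (fun t => b t / a t) < 1) :
    SecondOrderDelay.ExponentiallyStable a b g h := by
  have hδ0 : 0 ≤ δ := by linarith [hδ t₀ le_rfl, hgt t₀ ht₀]
  have hτ0 : 0 ≤ τ := by linarith [hτ t₀ le_rfl, hht t₀ ht₀]
  have ht₀₁ : t₀ ≤ t₁ := by linarith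
  have hbound : ∀ f : ℝ → ℝ, MemLp f ⊤ (volume.restrict (Set.Ici 0)) →
      ∃ c, 0 ≤ c ∧ ∀ᵐ t, 0 ≤ t → |f t| ≤ c := fun f hf =>
    ⟨_, lpNorm_nonneg, (ae_restrict_iff' measurableSet_Ici).1 (ae_le_lpNorm_exponent_top hf)⟩
  obtain ⟨A', hA', haA⟩ := hbound a ha
  obtain ⟨B', hB', hbB⟩ := hbound b hb
  have hinfa := ae_essInfFrom_le (T := t₀) (haA.mono fun t h1 h2 => h1 (ht₀.trans h2))
  have hinfb := ae_essInfFrom_le (T := t₀) (hbB.mono fun t h1 h2 => h1 (ht₀.trans h2))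
  have hsupb := ae_le_essSupFrom (T := t₀) (hbB.mono fun t h1 h2 => h1 (ht₀.trans h2))
  have hnorma := ae_abs_le_normLinfty (T := t₁)
    (haA.mono fun t h1 h2 => h1 (ht₀.trans (ht₀₁.trans h2)))
  have hnormb := ae_abs_le_normLinfty (T := t₁)
    (hbB.mono fun t h1 h2 => h1 (ht₀.trans (ht₀₁.trans h2)))
  set a₀ := essInfFrom t₀ a with ha₀
  set b₀ := essInfFrom t₀ b with hb₀
  have hnormab := ae_abs_le_normLinfty (T := t₁) (f := fun t => a t / b t) (c := A' / b₀) (by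
    filter_upwards [haA, hinfb] with t h1 h2 ht
    have h2 := h2 (ht₀₁.trans ht)
    rw [abs_div, abs_of_pos (hb_pos.trans_le h2)]
    exact div_le_div₀ hA' (h1 (ht₀.trans (ht₀₁.trans ht))) hb_pos h2)
  have hnormba := ae_abs_le_normLinfty (T := t₁) (f := fun t => b t / a t) (c := B' / a₀) (by
    filter_upwards [hbB, hinfa] with t h1 h2 ht
    have h2 := h2 (ht₀₁.trans ht)
    rw [abs_div, abs_of_pos (ha_pos.trans_le h2)]
    exact div_le_div₀ hB' (h1 (ht₀.trans (ht₀₁.trans ht))) ha_pos h2)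
  have hsq : ∀ᵐ t, t₁ ≤ t → b t ≤ (a₀ / 2) ^ 2 := by
    filter_upwards [hsupb] with t h1 ht
    linarith [h1 (ht₀₁.trans ht)]
  have hla : ∀ᵐ t, t₁ ≤ t → 2 * (a₀ / 2) ≤ a t := by
    filter_upwards [hinfa] with t h1 ht
    linarith [h1 (ht₀₁.trans ht)]
  have H : CoefficientBounds a b g h t₁ δ τ (a₀ / 2) b₀ (normLinfty t₁ a) (normLinfty t₁ b)
      (normLinfty t₁ fun t => a t / b t) (normLinfty t₁ fun t => b t / a t) :=
    { l_pos := by linarith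
      b₀_pos := hb_pos
      l_le := by
        obtain ⟨t, ht, h1, h2⟩ := exists_ge_of_ae (T := t₁) (p := fun t =>
          2 * (a₀ / 2) ≤ a t ∧ |a t| ≤ normLinfty t₁ a) (by
            filter_upwards [hla, hnorma] with t h1 h2 ht using ⟨h1 ht, h2 ht⟩)
        exact h1.trans ((le_abs_self _).trans h2)
      b₀_le := by
        obtain ⟨t, ht, h1, h2⟩ := exists_ge_of_ae (T := t₁) (p := fun t =>
          b₀ ≤ b t ∧ b t ≤ (a₀ / 2) ^ 2) (by
            filter_upwards [hinfb, hsq] with t h1 h2 ht using ⟨h1 (ht₀₁.trans ht), h2 ht⟩)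
        exact h1.trans h2
      B_nonneg := ENNReal.toReal_nonneg
      α_nonneg := ENNReal.toReal_nonneg
      β_nonneg := ENNReal.toReal_nonneg
      δ_nonneg := hδ0
      τ_nonneg := hτ0
      le_a := hla
      a_le := by filter_upwards [hnorma] with t h1 ht using (le_abs_self _).trans (h1 ht)
      le_b := by filter_upwards [hinfb] with t h1 ht using h1 (ht₀₁.trans ht)
      b_le := by filter_upwards [hnormb] with t h1 ht using (le_abs_self _).trans (h1 ht)
      b_le_sq := hsq
      a_le_b := by
        filter_upwards [hnormab, hinfb] with t h1 h2 ht
        rw [← div_le_iff₀ (hb_pos.trans_le (h2 (ht₀₁.trans ht)))]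
        exact (le_abs_self _).trans (h1 ht)
      b_le_a := by
        filter_upwards [hnormba, hinfa] with t h1 h2 ht
        rw [← div_le_iff₀ (ha_pos.trans_le (h2 (ht₀₁.trans ht)))]
        exact (le_abs_self _).trans (h1 ht)
      a_int := fun t ht t' htt' =>
        intervalIntegrable_of_memLp_top ha (ht₀.trans (ht₀₁.trans ht)) htt'
      g_mem := fun t ht =>
        ⟨by linarith [hδ t (ht₀₁.trans ht)], hgt t (ht₀.trans (ht₀₁.trans ht))⟩
      h_mem := fun t ht =>
        ⟨by linarith [hτ t (ht₀₁.trans ht)], hht t (ht₀.trans (ht₀₁.trans ht))⟩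
      integral_le := fun t ht => by
        have h1 := hint t (ht₀₁.trans ht)
        -- For `t ≥ t₁ ≥ t₀ + δ` one has `g t ≥ t - δ ≥ t₀ ≥ 0`, so the truncation at `0` is
        -- inactive.
        rwa [max_eq_left (by linarith [hδ t (ht₀₁.trans ht)])] at h1
      contraction := hmain }
  exact exponentiallyStable_of_coefficientBounds H (ht₀.trans ht₀₁) hA' hB' haA hbB hgt hht
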